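/- Let $k$ be a field of characteristic $0$ with algebraic closure $\bar k$, and let $n\ge 1$, $d\ge 1$ be integers. Let $X\subset\mathbb P^{2n+1}$ be a hypersurface defined by a homogeneous polynomial of degree $2d+1$ that is irreducible over $k$ (for instance any smooth cubic hypersurface if $d=1$). Assume that $X$ has multiplicity $d$ along each of two disjoint $n$-planes $H_+,H_-\subset\mathbb P^{2n+1}_{\bar k}$ which are conjugate over $k$, i.e. the conjugates of $H_+$ under $\mathrm{Gal}(\bar k/k)$ are exactly $H_+$ and $H_-$ (so that they are defined over a quadratic extension of $k$ and exchanged by its Galois group). Then: 1. $X$ is rational over $k$, i.e. birational over $k$ to $\mathbb P^{2n}_k$. 2. There is an $(n-1)$-plane $\Lambda\subset\mathbb P^{2n+1}$ defined over $k$ with $\Lambda\cap(H_+\cup H_-)=\emptyset$. 3. Let $\Lambda$ be any such $(n-1)$-plane. A linear projection from $\Lambda$ defined over $k$ identifies the $(n+1)$-planes containing $\Lambda$ with the lines in $\mathbb P^{n+1}$, that is, with the points of the Grassmannian $\mathbb G(1,n+1)$. A general $(n+1)$-plane $H\supset\Lambda$ meets $H_+$ in one point $p_1$ and $H_-$ in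 one point $p_2$, and the line $\langle p_1,p_2\rangle$ meets $X$ in exactly one point $x_H$ besides $p_1$ and $p_2$. The assignment $H\mapsto x_H$ is a birational map $\mathbb G(1,n+1)\dashrightarrow X$ defined over $k$. 4. If $H$ is an $(n+1)$-plane defined over $k$ for which $p_1,p_2,x_H$ exist as in 3, then $p_1$ and $p_2$ are conjugate over $k$ and $x_H$ is a $k$-rational point. -/

import Mathlib

/-! Varieties over a field `k` are described by their geometric points: subsets of the projective
space of `Ω = AlgebraicClosure k`, while equations, open sets and rational maps have their
coefficients in `k`. -/

/-- The set of points of the projective space of `ι → Ω`, for `Ω` the algebraic closure of `k`. -/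
abbrev PPoint (k : Type*) [Field k] (ι : Type*) : Type _ :=
  Projectivization (AlgebraicClosure k) (ι → AlgebraicClosure k)

/-- The hypersurface `F = 0`, for a homogeneous polynomial `F` over `k`. -/
def hypersurface {k : Type*} [Field k] {ι : Type*} (F : MvPolynomial ι k) : Set (PPoint k ι) :=
  {p | MvPolynomial.aeval p.rep F = 0}

/-- `P` holds at the general point of `X`: there is a homogeneous polynomial `q` over `k` such that
the open subset `q ≠ 0` of `X` is Zariski dense in `X` and `P` holds at each of its points. -/
def GenericallyOn {k : Type*} [Field k] {ι : Type*} (X : Set (PPoint k ι))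
    (P : PPoint k ι → Prop) : Prop :=
  ∃ (q : MvPolynomial ι k) (e : ℕ), q.IsHomogeneous e ∧
    (∀ x ∈ X, MvPolynomial.aeval x.rep q ≠ 0 → P x) ∧
    ∀ (h : MvPolynomial ι k) (m : ℕ), h.IsHomogeneous m →
      (∀ x ∈ X, MvPolynomial.aeval x.rep q ≠ 0 → MvPolynomial.aeval x.rep h = 0) →
      ∀ x ∈ X, MvPolynomial.aeval x.rep h = 0

/-- The map given in homogeneous coordinates by the polynomials `f j` over `k` is defined at `x`
and sends `x` to `y`. -/
def SendsTo {k : Type*} [Field k] {ι κ : Type*} (f : κ → MvPolynomial ι k)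
    (x : PPoint k ι) (y : PPoint k κ) : Prop :=
  ∃ h : (fun j => MvPolynomial.aeval x.rep (f j) : κ → AlgebraicClosure k) ≠ 0,
    Projectivization.mk (AlgebraicClosure k) _ h = y

/-- The tuples `f` and `g` of homogeneous polynomials over `k` define mutually inverse birational
maps, defined over `k`, between `X` and `Y`. -/
def AreInverseBirational {k : Type*} [Field k] {ι κ : Type*}
    (X : Set (PPoint k ι)) (Y : Set (PPoint k κ))
    (f : κ → MvPolynomial ι k) (g : ι → MvPolynomial κ k) : Prop :=
  (∃ e : ℕ, ∀ j, (f j).IsHomogeneous e) ∧ (∃ e : ℕ, ∀ i, (g i).IsHomogeneous e) ∧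
    GenericallyOn X (fun x => ∃ y ∈ Y, SendsTo f x y ∧ SendsTo g y x) ∧
    GenericallyOn Y (fun y => ∃ x ∈ X, SendsTo g y x ∧ SendsTo f x y)

/-- `X` is birational over `k` to the projective space of dimension `m`. -/
def IsRationalOver {k : Type*} [Field k] {ι : Type*} (m : ℕ) (X : Set (PPoint k ι)) : Prop :=
  ∃ (f : ι → MvPolynomial (Fin (m + 1)) k) (g : Fin (m + 1) → MvPolynomial ι k),
    AreInverseBirational Set.univ X f g

/-- The multiplicity of the hypersurface `F = 0` at the point with homogeneous coordinates `v`: the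
order of the Taylor expansion of `F` at `v`. -/
noncomputable def multiplicityAt {k : Type*} [Field k] {ι : Type*} (F : MvPolynomial ι k)
    (v : ι → AlgebraicClosure k) : ℕ∞ :=
  ((MvPolynomial.aeval (fun i => MvPolynomial.X i + MvPolynomial.C (v i)) F :
    MvPolynomial ι (AlgebraicClosure k)) : MvPowerSeries ι (AlgebraicClosure k)).order

/-- The multiplicity of the hypersurface `F = 0` along the linear space of lines in `W`, that is,
its multiplicity at the general (equivalently, its least multiplicity at any) point of it. -/
noncomputable def multiplicityAlong {k : Type*} [Field k] {ι : Type*} (F : MvPolynomial ι k)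
    (W : Submodule (AlgebraicClosure k) (ι → AlgebraicClosure k)) : ℕ∞ :=
  ⨅ v : {v : ι → AlgebraicClosure k // v ∈ W ∧ v ≠ 0}, multiplicityAt F v

/-- The image of `W` under the automorphism `σ` acting on coordinates. -/
def galoisImage {k : Type*} [Field k] {ι : Type*}
    (σ : AlgebraicClosure k ≃ₐ[k] AlgebraicClosure k)
    (W : Submodule (AlgebraicClosure k) (ι → AlgebraicClosure k)) :
    Submodule (AlgebraicClosure k) (ι → AlgebraicClosure k) where
  carrier := {v | (fun i => σ.symm (v i)) ∈ W}
  add_mem' := by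
    intro a b ha hb
    have h := W.add_mem ha hb
    simp only [Set.mem_ofPred_eq, Pi.add_apply, map_add]
    exact h
  zero_mem' := by
    simp only [Set.mem_ofPred_eq, Pi.zero_apply, map_zero]
    exact W.zero_mem
  smul_mem' := by
    intro c v hv
    have h := W.smul_mem (σ.symm c) hv
    simp only [Set.mem_ofPred_eq, Pi.smul_apply, smul_eq_mul, map_mul]
    exact h

/-- `W` and `W'` are conjugate over `k`: the conjugates of `W` under the absolute Galois group of
`k` are `W` and `W'`. -/
def AreConjugate {k : Type*} [Field k] {ι : Type*}
    (W W' : Submodule (AlgebraicClosure k) (ι → AlgebraicClosure k)) : Prop :=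
  Set.range (fun σ : AlgebraicClosure k ≃ₐ[k] AlgebraicClosure k => galoisImage σ W) = {W, W'}

/-- The extension of scalars of a linear subspace from `k` to its algebraic closure. -/
noncomputable def extendScalarsToClosure {k : Type*} [Field k] {ι : Type*} (W : Submodule k (ι → k)) :
    Submodule (AlgebraicClosure k) (ι → AlgebraicClosure k) :=
  Submodule.span (AlgebraicClosure k)
    ((fun (v : ι → k) (i : ι) => algebraMap k (AlgebraicClosure k) (v i)) '' (W : Set (ι → k)))

/-- The point has homogeneous coordinates in `k`. -/
def IsRationalPoint {k : Type*} [Field k] {ι : Type*} (x : PPoint k ι) : Prop :=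
  ∃ (v : ι → k) (h : (fun i => algebraMap k (AlgebraicClosure k) (v i)) ≠ 0),
    x = Projectivization.mk (AlgebraicClosure k) _ h

/-- The index set of the Plücker coordinates of two-dimensional subspaces of an `m`-dimensional
coordinate space. -/
abbrev PluckerIndex (m : ℕ) : Type := {s : Fin m × Fin m // s.1 < s.2}

/-- `P` is the Plücker point of the two-dimensional space `l` (a line in projective space). The
Plücker vector of two vectors is nonzero exactly if they are linearly independent. -/
def IsPluckerPoint {k : Type*} [Field k] {m : ℕ}
    (l : Submodule (AlgebraicClosure k) (Fin m → AlgebraicClosure k))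
    (P : PPoint k (PluckerIndex m)) : Prop :=
  ∃ a b : Fin m → AlgebraicClosure k, Submodule.span (AlgebraicClosure k) {a, b} = l ∧
    ∃ h : (fun s : PluckerIndex m => a s.1.1 * b s.1.2 - a s.1.2 * b s.1.1) ≠ 0,
      P = Projectivization.mk (AlgebraicClosure k) _ h

/-- The Grassmannian of lines in the projective space of dimension `m - 1`, in its Plücker
embedding. -/
def grassmannianOfLines (k : Type*) [Field k] (m : ℕ) : Set (PPoint k (PluckerIndex m)) :=
  {P | ∃ l, IsPluckerPoint l P}

/-- The linear space of `H` meets those of `Wp` and `Wm` each in one point, `p` and `q`, and `x` is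
the one point other than `p` and `q` in which the line through `p` and `q` meets `X`. -/
def IsThirdPoint {k : Type*} [Field k] {ι : Type*} (X : Set (PPoint k ι))
    (Wp Wm H : Submodule (AlgebraicClosure k) (ι → AlgebraicClosure k))
    (p q x : PPoint k ι) : Prop :=
  H ⊓ Wp = p.submodule ∧ H ⊓ Wm = q.submodule ∧
    {y | y ∈ X ∧ y.submodule ≤ p.submodule ⊔ q.submodule} \ {p, q} = {x}

open MvPolynomial

/-! The conjugate pair is encoded by one matrix over `k`. The involution that is 1 on `Wp` and -1 on
`Wm` is carried by Galois to plus or minus itself. Dividing it by a nonzero entry gives `J` over `k`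
with `J² = D`, where `D` is not a square, whose eigenspaces for `δ` and `-δ` (`δ² = D`) are the two
spaces (`AreConjugate.exists_matrix`).

Write `v = a + b` with `a`, `b` in these eigenspaces. Multiplicity `d` at both points forces `F(sa +
tb) = s^d t^d (sP + tQ)` (`exists_aeval_smul_add_smul`), so the residual point of the line is `Qa -
Pb`. Up to a scalar it equals `D^d F(v) Jv - (-1)^d F(Jv) v`, which has coefficients in `k` although
`a`, `b`, `P`, `Q` do not (`thirdPointMap`).

Up to a scalar this map depends only on the class of `v` under independent scalings of `a` and `b`
(`IsTwist`). It takes values in `X`, and at a general point of `X` it is the identity of projective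
points. So `X` is generically a set of representatives of the twist classes, and every other such
set defined over `k` is birational to `X`. Two of them are used. The first is a hyperplane `ℓ = 0`,
for which `balancedMap` is the same construction with `d = 0`; it gives rationality. The second is
the Grassmannian: the projection `A` from `Λ` maps the two eigenspaces isomorphically onto the
hyperplanes `α + δβ = 0` and `α - δβ = 0`, a general line meets each in one point, and these points
lift to unique `a` and `b`. The sum `a + b` is linear over `k` in the Plücker coordinates
(`LiftData`), and the way back sends `v` to the line joining `Av` and `AJv`, which is the line
joining `Aa` and `Ab`.

Genericity is measured by `D^(2d+1) g(v)² - g(Jv)²`, a constant times `PQ` at `a + b` (`normForm`).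
At a vector over `k` with `g(v) ≠ 0` it cannot vanish, since `D` is not a square; hence the open
sets needed are nonempty. For the last claim, Galois permutes `p` and `q` and preserves `X` and
their line, hence fixes the single further point of intersection. -/

theorem aeval_smul_of_isHomogeneous {k K ι : Type*} [Field k] [Field K] [Algebra k K]
    {F : MvPolynomial ι k} {m : ℕ} (hF : F.IsHomogeneous m) (c : K) (v : ι → K) :
    aeval (c • v) F = c ^ m * aeval v F := by
  rw [aeval_def, aeval_def, eval₂_eq, eval₂_eq, Finset.mul_sum]
  refine Finset.sum_congr rfl fun s hs => ?_
  have hdeg : ∑ i ∈ s.support, s i = m := by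
    have := hF (mem_support_iff.mp hs)
    rwa [Finsupp.weight_apply, Finsupp.sum, Finset.sum_congr rfl
      (fun i _ => show s i • (1 : ι → ℕ) i = s i by simp)] at this
  simp only [Pi.smul_apply, smul_eq_mul, mul_pow, Finset.prod_mul_distrib,
    Finset.prod_pow_eq_pow_sum, hdeg]
  ring

theorem exists_aeval_ne_zero {k K ι : Type*} [Field k] [CharZero k] [Field K] [Algebra k K]
    {F : MvPolynomial ι k} (hF : F ≠ 0) :
    ∃ v : ι → k, aeval (fun i => algebraMap k K (v i)) F ≠ 0 := by
  by_contra! h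
  refine hF (MvPolynomial.funext fun v => ?_)
  have := h v
  rw [show (fun i => algebraMap k K (v i)) = algebraMap k K ∘ v from rfl,
    aeval_algebraMap_apply] at this
  simpa [aeval_eq_eval] using this

theorem eq_zero_of_forall_aeval_eq_zero {k K ι : Type*} [Field k] [CharZero k] [Field K]
    [Algebra k K] {F : MvPolynomial ι k} (h : ∀ v : ι → K, aeval v F = 0) : F = 0 := by
  by_contra hF
  obtain ⟨v, hv⟩ := exists_aeval_ne_zero (K := K) hF
  exact hv (h _)

/-! ### Projective points, homogeneous maps and dense open subsets -/

section Points

variable {k ι κ : Type*} [Field k]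

local notation "Ω" => AlgebraicClosure k

theorem mem_hypersurface_mk {F : MvPolynomial ι k} {m : ℕ} (hF : F.IsHomogeneous m)
    {v : ι → Ω} (hv : v ≠ 0) :
    Projectivization.mk Ω v hv ∈ hypersurface F ↔ aeval v F = 0 := by
  obtain ⟨a, ha⟩ := Projectivization.exists_smul_eq_mk_rep Ω v hv
  change aeval (Projectivization.mk Ω v hv).rep F = 0 ↔ _
  rw [← ha, Units.smul_def, aeval_smul_of_isHomogeneous hF]
  simp

theorem aeval_rep_mk_ne_zero {q : MvPolynomial ι k} {m : ℕ} (hq : q.IsHomogeneous m)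
    {v : ι → Ω} (hv : v ≠ 0) :
    aeval (Projectivization.mk Ω v hv).rep q ≠ 0 ↔ aeval v q ≠ 0 :=
  (mem_hypersurface_mk hq hv).not

theorem sendsTo_mk {f : κ → MvPolynomial ι k} {m : ℕ} (hf : ∀ j, (f j).IsHomogeneous m)
    {v : ι → Ω} (hv : v ≠ 0) {w : κ → Ω} (hw : w ≠ 0) {c : Ω} (hc : c ≠ 0)
    (h : (fun j => aeval v (f j)) = c • w) :
    SendsTo f (Projectivization.mk Ω v hv) (Projectivization.mk Ω w hw) := by
  obtain ⟨a, ha⟩ := Projectivization.exists_smul_eq_mk_rep Ω v hv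
  have key : (fun j => aeval (Projectivization.mk Ω v hv).rep (f j)) = ((a : Ω) ^ m * c) • w := by
    rw [mul_smul, ← h, ← ha, Units.smul_def]
    ext j
    simp [aeval_smul_of_isHomogeneous (hf j)]
  have hne : ((a : Ω) ^ m * c) ≠ 0 := by simp [hc]
  refine ⟨by rw [key]; exact smul_ne_zero hne hw, ?_⟩
  rw [Projectivization.mk_eq_mk_iff']
  exact ⟨_, key.symm⟩

/-- A nonempty open subset of a hypersurface irreducible over `k` is dense. -/
theorem genericallyOn_hypersurface {F q : MvPolynomial ι k} {m e : ℕ} [Finite ι]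
    (hF : F.IsHomogeneous m) (hFirr : Irreducible F) (hq : q.IsHomogeneous e)
    {v₀ : ι → Ω} (hv₀ : v₀ ≠ 0) (hFv₀ : aeval v₀ F = 0) (hqv₀ : aeval v₀ q ≠ 0)
    {P : PPoint k ι → Prop}
    (hP : ∀ (v : ι → Ω) (hv : v ≠ 0), aeval v F = 0 → aeval v q ≠ 0 →
      P (Projectivization.mk Ω v hv)) :
    GenericallyOn (hypersurface F) P := by
  refine ⟨q, e, hq, fun x hx hqx => ?_, fun h r hh hvan x hx => ?_⟩
  · have := hP x.rep x.rep_nonzero hx hqx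
    rwa [Projectivization.mk_rep] at this
  · have hvan' : ∀ v : ι → Ω, v ≠ 0 → aeval v F = 0 → aeval v q ≠ 0 → aeval v h = 0 := by
      intro v hv hFv hqv
      have := hvan (Projectivization.mk Ω v hv) ((mem_hypersurface_mk hF hv).2 hFv)
        ((aeval_rep_mk_ne_zero hq hv).2 hqv)
      exact (mem_hypersurface_mk hh hv).1 this
    -- Nullstellensatz on the affine cone: `h * q` vanishes on it, so the prime `F` divides `h` or
    -- `q`, and the point `v₀` excludes `q`.
    have hmem : h * q ∈ vanishingIdeal k (zeroLocus Ω (Ideal.span {F})) := by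
      intro v hv
      have hFv : aeval v F = 0 := hv F (Ideal.mem_span_singleton_self F)
      rw [map_mul]
      by_cases hqv : aeval v q = 0
      · rw [hqv, mul_zero]
      -- The vertex of the cone is no projective point. There `h` vanishes if its degree is
      -- positive; otherwise it is constant and takes its value at `v₀`.
      rcases eq_or_ne v 0 with rfl | hv0
      · rcases Nat.eq_zero_or_pos r with rfl | hr
        · have h0 := hvan' v₀ hv₀ hFv₀ hqv₀
          have := aeval_smul_of_isHomogeneous hh (0 : Ω) v₀
          rw [zero_smul, h0] at this
          rw [this]; simp
        · have := aeval_smul_of_isHomogeneous hh (0 : Ω) v₀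
          rw [zero_smul, zero_pow hr.ne', zero_mul] at this
          rw [this, zero_mul]
      · rw [hvan' v hv0 hFv hqv, zero_mul]
    have hprime : Prime F := hFirr.prime
    have : (Ideal.span {F}).IsPrime := (Ideal.span_singleton_prime hFirr.ne_zero).2 hprime
    rw [IsPrime.vanishingIdeal_zeroLocus, Ideal.mem_span_singleton] at hmem
    rcases hprime.dvd_or_dvd hmem with ⟨u, rfl⟩ | ⟨u, rfl⟩
    · have hFx : aeval x.rep F = 0 := hx
      rw [map_mul, hFx, zero_mul]
    · rw [map_mul, hFv₀, zero_mul] at hqv₀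
      exact absurd rfl hqv₀

/-- A nonempty open subset of a unirational variety is dense. -/
theorem genericallyOn_of_parametrization [CharZero k] {τ : Type*} {X : Set (PPoint k ι)}
    (φ : ι → MvPolynomial τ k)
    (hsurj : ∀ x ∈ X, ∃ (t : τ → Ω) (h : (fun i => aeval t (φ i)) ≠ 0),
      x = Projectivization.mk Ω _ h)
    (hmem : ∀ (t : τ → Ω) (h : (fun i => aeval t (φ i)) ≠ 0), Projectivization.mk Ω _ h ∈ X)
    {q : MvPolynomial ι k} {e : ℕ} (hq : q.IsHomogeneous e) {t₀ : τ → Ω}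
    (ht₀ : (fun i => aeval t₀ (φ i)) ≠ 0) (hqt₀ : aeval (fun i => aeval t₀ (φ i)) q ≠ 0)
    {P : PPoint k ι → Prop}
    (hP : ∀ (t : τ → Ω) (h : (fun i => aeval t (φ i)) ≠ 0),
      aeval (fun i => aeval t (φ i)) q ≠ 0 → P (Projectivization.mk Ω _ h)) :
    GenericallyOn X P := by
  refine ⟨q, e, hq, fun x hx hqx => ?_, fun h r hh hvan x hx => ?_⟩
  · obtain ⟨t, ht, rfl⟩ := hsurj x hx
    exact hP t ht ((aeval_rep_mk_ne_zero hq ht).1 hqx)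
  · obtain ⟨i, hi⟩ : ∃ i, aeval t₀ (φ i) ≠ 0 := by
      by_contra! hcon
      exact ht₀ (_root_.funext hcon)
    have hcomp : ∀ (t : τ → Ω) (g : MvPolynomial ι k),
        aeval t (aeval φ g) = aeval (fun i => aeval t (φ i)) g := fun t g => by
      rw [← comp_aeval_apply]
    -- The factor `φ i` covers the parameters at which `φ` is undefined. One of the three factors is
    -- zero in the polynomial ring, and `t₀` leaves only the first.
    have hzero : aeval φ h * aeval φ q * φ i = 0 := by
      refine eq_zero_of_forall_aeval_eq_zero (K := Ω) fun t => ?_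
      rw [map_mul, map_mul, hcomp, hcomp]
      by_cases ht : (fun i => aeval t (φ i)) = 0
      · rw [congrFun ht i]; simp
      by_cases hqt : aeval (fun i => aeval t (φ i)) q = 0
      · rw [hqt]; simp
      · have := hvan _ (hmem t ht) ((aeval_rep_mk_ne_zero hq ht).2 hqt)
        rw [show aeval (fun i => aeval t (φ i)) h = 0 from (mem_hypersurface_mk hh ht).1 this]
        simp
    have hh0 : aeval φ h = 0 := by
      rcases mul_eq_zero.1 hzero with h1 | h1
      · rcases mul_eq_zero.1 h1 with h2 | h2
        · exact h2
        · exact absurd (by rw [← hcomp, h2, map_zero]) hqt₀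
      · exact absurd (by rw [h1, map_zero]) hi
    obtain ⟨t, ht, rfl⟩ := hsurj x hx
    exact (mem_hypersurface_mk hh ht).2 (by rw [← hcomp, hh0, map_zero])

end Points

/-! ### Multiplicity and restriction to lines -/

section Multiplicity

variable {k ι : Type*} [Field k]

local notation "Ω" => AlgebraicClosure k

/-- Each monomial of the Taylor expansion at `a` has degree at least `d`, so on the line `a + tb` it
contributes a multiple of `t^d`. -/
theorem exists_aeval_add_smul_eq_pow_mul {F : MvPolynomial ι k} {d : ℕ} {a : ι → Ω}
    (h : (d : ℕ∞) ≤ multiplicityAt F a) (b : ι → Ω) :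
    ∃ r : Polynomial Ω, ∀ t : Ω, aeval (a + t • b) F = t ^ d * r.eval t := by
  set G : MvPolynomial ι Ω :=
    aeval (fun i => MvPolynomial.X i + MvPolynomial.C (a i)) F with hG
  have heval : ∀ v : ι → Ω, eval v G = aeval (a + v) F := by
    intro v
    rw [hG, ← MvPolynomial.coe_aeval_eq_eval, RingHom.coe_coe]
    have := (comp_aeval_apply (fun i => (X i + C (a i) : MvPolynomial ι Ω))
      ((aeval v : MvPolynomial ι Ω →ₐ[Ω] Ω).restrictScalars k) F)
    simp only [AlgHom.restrictScalars_apply] at this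
    rw [this]
    congr 2
    ext i
    simp [add_comm]
  have hcoeff : ∀ s : ι →₀ ℕ, coeff s G ≠ 0 → d ≤ s.degree := by
    intro s hs
    by_contra! hlt
    refine hs ?_
    have := MvPowerSeries.coeff_of_lt_order (d := s) (f := (G : MvPowerSeries ι Ω))
      (lt_of_lt_of_le (by exact_mod_cast hlt) h)
    simpa using this
  refine ⟨∑ s ∈ G.support, Polynomial.C (coeff s G * ∏ i ∈ s.support, b i ^ s i) *
    Polynomial.X ^ (s.degree - d), fun t => ?_⟩
  rw [← heval, eval_eq, Polynomial.eval_finsetSum, Finset.mul_sum]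
  refine Finset.sum_congr rfl fun s hs => ?_
  have hd := hcoeff s (mem_support_iff.1 hs)
  simp only [Pi.smul_apply, smul_eq_mul, mul_pow, Finset.prod_mul_distrib,
    Finset.prod_pow_eq_pow_sum, Polynomial.eval_mul, Polynomial.eval_C, Polynomial.eval_pow,
    Polynomial.eval_X]
  rw [show ∑ i ∈ s.support, s i = d + (s.degree - d) by rw [Nat.add_sub_cancel' hd]; rfl, pow_add]
  ring

theorem aeval_eq_zero_of_one_le_multiplicityAt {F : MvPolynomial ι k} {d : ℕ} (hd : 1 ≤ d)
    {a : ι → Ω} (h : (d : ℕ∞) ≤ multiplicityAt F a) : aeval a F = 0 := by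
  obtain ⟨r, hr⟩ := exists_aeval_add_smul_eq_pow_mul h 0
  have := hr 0
  rwa [smul_zero, add_zero, zero_pow (by omega), zero_mul] at this

/-- A form of degree `2d+1` with multiplicity `d` at two points restricts to the line through
them as a linear form times the `d`-th power of the equation of the two points. -/
theorem exists_aeval_smul_add_smul [CharZero k] {F : MvPolynomial ι k} {d : ℕ} (hd : 1 ≤ d)
    (hF : F.IsHomogeneous (2 * d + 1)) {a b : ι → Ω}
    (ha : a ≠ 0 → (d : ℕ∞) ≤ multiplicityAt F a) (hb : b ≠ 0 → (d : ℕ∞) ≤ multiplicityAt F b) :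
    ∃ P Q : Ω, ∀ s t : Ω, aeval (s • a + t • b) F = s ^ d * t ^ d * (s * P + t * Q) := by
  have h0 : aeval (0 : ι → Ω) F = 0 := by
    have := aeval_smul_of_isHomogeneous hF (0 : Ω) (0 : ι → Ω)
    rwa [zero_smul, zero_pow (by omega), zero_mul] at this
  have hFa : aeval a F = 0 := by
    by_cases h : a = 0
    · rw [h, h0]
    · exact aeval_eq_zero_of_one_le_multiplicityAt hd (ha h)
  have hFb : aeval b F = 0 := by
    by_cases h : b = 0
    · rw [h, h0]
    · exact aeval_eq_zero_of_one_le_multiplicityAt hd (hb h)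
  by_cases ha0 : a = 0
  · refine ⟨0, 0, fun s t => ?_⟩
    rw [ha0, smul_zero, zero_add, aeval_smul_of_isHomogeneous hF, hFb]; ring
  by_cases hb0 : b = 0
  · refine ⟨0, 0, fun s t => ?_⟩
    rw [hb0, smul_zero, add_zero, aeval_smul_of_isHomogeneous hF, hFa]; ring
  obtain ⟨r, hr⟩ := exists_aeval_add_smul_eq_pow_mul (ha ha0) b
  obtain ⟨r', hr'⟩ := exists_aeval_add_smul_eq_pow_mul (hb hb0) a
  have hsc : ∀ s t : Ω, s ≠ 0 → aeval (s • a + t • b) F =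
      s ^ (2 * d + 1) * ((t / s) ^ d * r.eval (t / s)) := by
    intro s t hs
    rw [← hr, ← aeval_smul_of_isHomogeneous hF, smul_add, smul_smul, mul_div_cancel₀ _ hs]
  -- The expansions from `a` and from `b` describe the same binary form. Comparing them in degree
  -- `2d + 1` leaves `r'(s) = s r(1/s)`, which is a polynomial only if `r` has degree at most 1.
  have hrel : ∀ s : Ω, s ≠ 0 → r'.eval s = s * r.eval s⁻¹ := by
    intro s hs
    have h1 := hsc s 1 hs
    rw [one_smul, add_comm, hr' s, one_div, inv_pow,
      show s ^ (2 * d + 1) = s ^ d * s ^ d * s by ring] at h1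
    have hsd : s ^ d ≠ 0 := pow_ne_zero _ hs
    field_simp at h1
    rw [← one_div]
    exact h1
  have hdeg : r.natDegree ≤ 1 := by
    by_contra! hlt
    -- If `deg r ≥ 2`, then after cancelling one `X` the left side still vanishes at 0, while the
    -- right side takes the leading coefficient of `r` there.
    have hpoly : Polynomial.X ^ r.natDegree * r' = Polynomial.X * r.reverse := by
      refine Polynomial.eq_of_infinite_eval_eq _ _
        (Set.Infinite.mono (s := {0}ᶜ) ?_ (Set.finite_singleton _).infinite_compl)
      intro s hs
      have hs' : s ≠ 0 := hs
      let := invertibleOfNonzero (inv_ne_zero hs')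
      have hrev := Polynomial.eval₂_reverse_mul_pow (RingHom.id Ω) s⁻¹ r
      rw [invOf_eq_inv, inv_inv] at hrev
      simp only [Polynomial.eval₂_id] at hrev
      change Polynomial.eval s _ = Polynomial.eval s _
      rw [Polynomial.eval_mul, Polynomial.eval_mul, Polynomial.eval_pow, Polynomial.eval_X,
        hrel s hs', ← hrev, inv_pow]
      field_simp
    obtain ⟨m, hm⟩ : ∃ m, r.natDegree = m + 2 := ⟨r.natDegree - 2, by omega⟩
    rw [hm, show (Polynomial.X : Polynomial Ω) ^ (m + 2) * r' =
      Polynomial.X * (Polynomial.X ^ (m + 1) * r') by ring] at hpoly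
    have := mul_left_cancel₀ Polynomial.X_ne_zero hpoly
    have h2 := congrArg (Polynomial.eval 0) this
    rw [← Polynomial.coeff_zero_eq_eval_zero r.reverse, Polynomial.coeff_zero_reverse] at h2
    simp only [Polynomial.eval_mul, Polynomial.eval_pow, Polynomial.eval_X, ne_eq,
      Nat.succ_ne_zero, not_false_eq_true, zero_pow, zero_mul] at h2
    rw [eq_comm, Polynomial.leadingCoeff_eq_zero] at h2
    rw [h2] at hm
    simp at hm
  refine ⟨r.coeff 0, r.coeff 1, fun s t => ?_⟩
  by_cases hs : s = 0
  · rw [hs, zero_smul, zero_add, aeval_smul_of_isHomogeneous hF, hFb,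
      zero_pow (show d ≠ 0 by omega)]
    ring
  · rw [hsc s t hs, Polynomial.eq_X_add_C_of_natDegree_le_one hdeg]
    simp only [Polynomial.eval_add, Polynomial.eval_mul, Polynomial.eval_C, Polynomial.eval_X,
      Polynomial.coeff_add, Polynomial.coeff_C_mul, Polynomial.coeff_X_zero, Polynomial.coeff_C_zero,
      Polynomial.coeff_X_one, Polynomial.coeff_C_succ]
    rw [div_pow, show s ^ (2 * d + 1) = s ^ d * s ^ d * s by ring]
    field_simp
    ring

end Multiplicity

/-! ### Galois action and descent of the pair of subspaces -/

section Galois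

variable {k ι : Type*} [Field k]

local notation "Ω" => AlgebraicClosure k

theorem mem_galoisImage {σ : Ω ≃ₐ[k] Ω} {W : Submodule Ω (ι → Ω)} {v : ι → Ω} :
    v ∈ galoisImage σ W ↔ (fun i => σ.symm (v i)) ∈ W :=
  Iff.rfl

theorem map_mem_galoisImage {σ : Ω ≃ₐ[k] Ω} {W : Submodule Ω (ι → Ω)} {v : ι → Ω} :
    (fun i => σ (v i)) ∈ galoisImage σ W ↔ v ∈ W := by
  simp [mem_galoisImage]

theorem galoisImage_mul (σ τ : Ω ≃ₐ[k] Ω) (W : Submodule Ω (ι → Ω)) :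
    galoisImage (σ * τ) W = galoisImage σ (galoisImage τ W) :=
  Submodule.ext fun _ => Iff.rfl

theorem galoisImage_one (W : Submodule Ω (ι → Ω)) : galoisImage (1 : Ω ≃ₐ[k] Ω) W = W :=
  Submodule.ext fun _ => Iff.rfl

theorem galoisImage_injective (σ : Ω ≃ₐ[k] Ω) :
    Function.Injective (galoisImage (ι := ι) σ) := fun W W' h => by
  have := congrArg (galoisImage σ⁻¹) h
  rwa [← galoisImage_mul, ← galoisImage_mul, inv_mul_cancel, galoisImage_one, galoisImage_one]
    at this

theorem galoisImage_inf (σ : Ω ≃ₐ[k] Ω) (W W' : Submodule Ω (ι → Ω)) :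
    galoisImage σ (W ⊓ W') = galoisImage σ W ⊓ galoisImage σ W' :=
  Submodule.ext fun _ => Iff.rfl

theorem galoisImage_extendScalarsToClosure_le (σ : Ω ≃ₐ[k] Ω) (W : Submodule k (ι → k)) :
    extendScalarsToClosure W ≤ galoisImage σ (extendScalarsToClosure W) := by
  refine Submodule.span_le.2 ?_
  rintro _ ⟨v, hv, rfl⟩
  change _ ∈ extendScalarsToClosure W
  simp only [AlgEquiv.commutes]
  exact Submodule.subset_span ⟨v, hv, rfl⟩

theorem galoisImage_extendScalarsToClosure (σ : Ω ≃ₐ[k] Ω) (W : Submodule k (ι → k)) :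
    galoisImage σ (extendScalarsToClosure W) = extendScalarsToClosure W := by
  refine le_antisymm (fun v hv => ?_) (galoisImage_extendScalarsToClosure_le σ W)
  have := galoisImage_extendScalarsToClosure_le σ⁻¹ W hv
  rw [mem_galoisImage] at this
  convert! this using 1
  ext i
  exact (σ.apply_symm_apply (v i)).symm

theorem exists_algebraMap_eq_of_fixed [CharZero k] {x : Ω} (h : ∀ σ : Ω ≃ₐ[k] Ω, σ x = x) :
    ∃ y : k, algebraMap k Ω y = x :=
  (InfiniteGalois.mem_range_algebraMap_iff_fixed x).2 h

/-- Conjugacy only names the orbit of `W`. As `σ` permutes this orbit injectively, the image of `W`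
determines that of `W'`. -/
theorem AreConjugate.galoisImage_eq {W W' : Submodule Ω (ι → Ω)} (h : AreConjugate W W')
    (hne : W ≠ W') (σ : Ω ≃ₐ[k] Ω) :
    (galoisImage σ W = W ∧ galoisImage σ W' = W') ∨
      (galoisImage σ W = W' ∧ galoisImage σ W' = W) := by
  have hmem : ∀ τ : Ω ≃ₐ[k] Ω, galoisImage τ W = W ∨ galoisImage τ W = W' := fun τ => by
    have : galoisImage τ W ∈ ({W, W'} : Set _) := h ▸ ⟨τ, rfl⟩
    simpa using this
  obtain ⟨τ, hτ⟩ : ∃ τ : Ω ≃ₐ[k] Ω, galoisImage τ W = W' := by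
    have : W' ∈ Set.range (fun σ : Ω ≃ₐ[k] Ω => galoisImage σ W) := by
      rw [show Set.range _ = _ from h]; simp
    exact this
  have h2 := hmem (σ * τ)
  rw [galoisImage_mul, hτ] at h2
  rcases hmem σ with h1 | h1
  · refine Or.inl ⟨h1, h2.resolve_left fun h3 => hne ?_⟩
    exact galoisImage_injective σ (h1.trans h3.symm)
  · refine Or.inr ⟨h1, h2.resolve_right fun h3 => hne ?_⟩
    exact galoisImage_injective σ (h1.trans h3.symm)

theorem AreConjugate.exists_galoisImage_eq {W W' : Submodule Ω (ι → Ω)} (h : AreConjugate W W') :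
    ∃ σ : Ω ≃ₐ[k] Ω, galoisImage σ W = W' := by
  have : W' ∈ Set.range (fun σ : Ω ≃ₐ[k] Ω => galoisImage σ W) := by
    rw [show Set.range _ = _ from h]; simp
  exact this

/-- Two complementary conjugate subspaces are the eigenspaces of a square root, defined over `k`,
of a scalar matrix. -/
theorem AreConjugate.exists_matrix [CharZero k] [Fintype ι] [DecidableEq ι]
    {W W' : Submodule Ω (ι → Ω)}
    (h : AreConjugate W W') (hc : IsCompl W W') (hW : W ≠ ⊥) :
    ∃ (J : Matrix ι ι k) (D : k) (δ : Ω), ¬ IsSquare D ∧ δ ^ 2 = algebraMap k Ω D ∧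
      J * J = D • 1 ∧
      (∀ v, v ∈ W ↔ (J.map (algebraMap k Ω)).mulVec v = δ • v) ∧
      (∀ v, v ∈ W' ↔ (J.map (algebraMap k Ω)).mulVec v = (-δ) • v) := by
  have hne : W ≠ W' := by
    rintro rfl
    exact hW (disjoint_self.1 hc.disjoint)
  -- The reflection with eigenspaces `W` and `W'`: an automorphism that fixes both commutes with it,
  -- and one that exchanges them turns it into its negative.
  let S : (ι → Ω) →ₗ[Ω] (ι → Ω) := LinearMap.ofIsCompl hc W.subtype (-W'.subtype)
  have hSW : ∀ a ∈ W, S a = a := fun a ha => LinearMap.ofIsCompl_apply_left hc ⟨a, ha⟩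
  have hSW' : ∀ b ∈ W', S b = -b := fun b hb => LinearMap.ofIsCompl_apply_right hc ⟨b, hb⟩
  have hdec : ∀ v : ι → Ω, ∃ a ∈ W, ∃ b ∈ W', v = a + b := fun v => by
    have : v ∈ W ⊔ W' := by rw [hc.sup_eq_top]; trivial
    obtain ⟨a, ha, b, hb, rfl⟩ := Submodule.mem_sup.1 this
    exact ⟨a, ha, b, hb, rfl⟩
  have hSS : ∀ v, S (S v) = v := fun v => by
    obtain ⟨a, ha, b, hb, rfl⟩ := hdec v
    rw [map_add, hSW a ha, hSW' b hb, map_add, hSW a ha, map_neg, hSW' b hb, neg_neg]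
  have hS : ∀ σ : Ω ≃ₐ[k] Ω, (galoisImage σ W = W ∧ ∀ v, (fun i => σ (S v i)) = S (fun i => σ (v i))) ∨
      (galoisImage σ W = W' ∧ ∀ v, (fun i => σ (S v i)) = -S (fun i => σ (v i))) := by
    intro σ
    have hsplit : ∀ a b : ι → Ω, (fun i => σ ((a + b) i)) = (fun i => σ (a i)) + fun i => σ (b i) :=
      fun a b => by ext i; simp
    have hsplit' : ∀ a b : ι → Ω, (fun i => σ ((a + -b) i)) = (fun i => σ (a i)) - fun i => σ (b i) :=
      fun a b => by ext i; simp [sub_eq_add_neg]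
    rcases h.galoisImage_eq hne σ with ⟨h1, h2⟩ | ⟨h1, h2⟩
    · refine Or.inl ⟨h1, fun v => ?_⟩
      obtain ⟨a, ha, b, hb, rfl⟩ := hdec v
      have ha' : (fun i => σ (a i)) ∈ W := h1 ▸ map_mem_galoisImage.2 ha
      have hb' : (fun i => σ (b i)) ∈ W' := h2 ▸ map_mem_galoisImage.2 hb
      rw [hsplit, map_add, map_add, hSW a ha, hSW' b hb, hSW _ ha', hSW' _ hb', hsplit']
      abel
    · refine Or.inr ⟨h1, fun v => ?_⟩
      obtain ⟨a, ha, b, hb, rfl⟩ := hdec v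
      have ha' : (fun i => σ (a i)) ∈ W' := h1 ▸ map_mem_galoisImage.2 ha
      have hb' : (fun i => σ (b i)) ∈ W := h2 ▸ map_mem_galoisImage.2 hb
      rw [hsplit, map_add, map_add, hSW a ha, hSW' b hb, hSW' _ ha', hSW _ hb', hsplit']
      abel
  let M : Matrix ι ι Ω := LinearMap.toMatrix' S
  have hM : ∀ v, M.mulVec v = S v := fun v => by
    rw [← Matrix.toLin'_apply, Matrix.toLin'_toMatrix']
  have hMij : ∀ i j, M i j = S (Pi.single j 1) i := fun i j => by
    simp [M, LinearMap.toMatrix'_apply]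
  have hsingle : ∀ (σ : Ω ≃ₐ[k] Ω) (j : ι),
      (fun i => σ ((Pi.single j 1 : ι → Ω) i)) = Pi.single j 1 := fun σ j => by
    ext i
    rcases eq_or_ne i j with rfl | hij
    · simp
    · simp [hij]
  have hMσ : ∀ σ : Ω ≃ₐ[k] Ω, (galoisImage σ W = W ∧ ∀ i j, σ (M i j) = M i j) ∨
      (galoisImage σ W = W' ∧ ∀ i j, σ (M i j) = - M i j) := by
    intro σ
    rcases hS σ with ⟨h1, h2⟩ | ⟨h1, h2⟩
    · refine Or.inl ⟨h1, fun i j => ?_⟩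
      have := congrFun (h2 (Pi.single j 1)) i
      rw [hsingle] at this
      rw [hMij]; exact this
    · refine Or.inr ⟨h1, fun i j => ?_⟩
      have := congrFun (h2 (Pi.single j 1)) i
      rw [hsingle] at this
      rw [hMij]; exact this
  obtain ⟨i₀, j₀, hs₀⟩ : ∃ i j, M i j ≠ 0 := by
    by_contra! hcon
    have hM0 : M = 0 := by ext i j; exact hcon i j
    refine hW (Submodule.eq_bot_iff _ |>.2 fun a ha => ?_)
    rw [← hSW a ha, ← hM, hM0, Matrix.zero_mulVec]
  set s := M i₀ j₀ with hs
  -- All entries of `M` change sign together, so quotients by the fixed entry `s` are Galois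
  -- invariant, and so is `s²`. Hence `J = M / s`, `δ = 1 / s`, `D = 1 / s²`.
  have hJ : ∀ i j, ∃ y : k, algebraMap k Ω y = M i j / s := fun i j => by
    refine exists_algebraMap_eq_of_fixed fun σ => ?_
    rcases hMσ σ with ⟨-, h2⟩ | ⟨-, h2⟩
    · rw [map_div₀, h2, hs, h2]
    · rw [map_div₀, h2, hs, h2, neg_div_neg_eq]
  choose J hJ using hJ
  obtain ⟨D, hD⟩ : ∃ D : k, algebraMap k Ω D = (s⁻¹) ^ 2 := by
    refine exists_algebraMap_eq_of_fixed fun σ => ?_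
    rcases hMσ σ with ⟨-, h2⟩ | ⟨-, h2⟩
    · rw [map_pow, map_inv₀, hs, h2]
    · rw [map_pow, map_inv₀, hs, h2, inv_neg, neg_sq]
  have hJM : (Matrix.of J).map (algebraMap k Ω) = s⁻¹ • M := by
    ext i j
    simp [hJ, div_eq_inv_mul]
  have hJv : ∀ v, ((Matrix.of J).map (algebraMap k Ω)).mulVec v = s⁻¹ • S v := fun v => by
    rw [hJM, Matrix.smul_mulVec, hM]
  have hsinv : s⁻¹ ≠ 0 := inv_ne_zero hs₀
  have h2 : (2 : Ω) ≠ 0 := by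
    have : CharZero Ω := algebraRat.charZero _
    exact two_ne_zero
  refine ⟨Matrix.of J, D, s⁻¹, ?_, hD.symm, ?_, fun v => ?_, fun v => ?_⟩
  -- A square `D` would put `s⁻¹` in `k`, whereas an automorphism exchanging the two spaces sends
  -- `s` to `-s`.
  · rintro ⟨c, hc'⟩
    obtain ⟨σ, hσ⟩ := h.exists_galoisImage_eq
    have hσs : σ s = -s := by
      rcases hMσ σ with ⟨h3, -⟩ | ⟨-, h3⟩
      · exact absurd (h3.symm.trans hσ) hne
      · exact h3 _ _
    have hfac : (s⁻¹ - algebraMap k Ω c) * (s⁻¹ + algebraMap k Ω c) = 0 := by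
      rw [hc', map_mul] at hD
      linear_combination -hD
    have hfix : σ s⁻¹ = s⁻¹ := by
      rcases mul_eq_zero.1 hfac with h3 | h3
      · rw [sub_eq_zero.1 h3, AlgEquiv.commutes]
      · rw [eq_neg_of_add_eq_zero_left h3, map_neg, AlgEquiv.commutes]
    rw [map_inv₀, hσs, inv_neg] at hfix
    have : 2 * s⁻¹ = 0 := by linear_combination -hfix
    exact hsinv ((mul_eq_zero.1 this).resolve_left h2)
  · have hinj : Function.Injective (fun A : Matrix ι ι k => A.map (algebraMap k Ω)) :=
      Matrix.map_injective (algebraMap k Ω).injective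
    refine hinj ?_
    have hMM : M * M = 1 := by
      rw [← LinearMap.toMatrix'_comp, show S ∘ₗ S = LinearMap.id from LinearMap.ext hSS,
        LinearMap.toMatrix'_id]
    change (Matrix.of J * Matrix.of J).map (algebraMap k Ω) = (D • (1 : Matrix ι ι k)).map _
    rw [Matrix.map_mul, hJM, Matrix.smul_mul, Matrix.mul_smul, hMM, smul_smul, ← pow_two, ← hD]
    ext i j
    rcases eq_or_ne i j with rfl | hij
    · simp
    · simp [hij]
  · rw [hJv]
    refine ⟨fun hv => by rw [hSW v hv], fun hv => ?_⟩
    have hSv := smul_right_injective _ hsinv hv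
    obtain ⟨a, ha, b, hb, rfl⟩ := hdec v
    rw [map_add, hSW a ha, hSW' b hb] at hSv
    have hb0 : b = 0 := by
      have : (2 : Ω) • b = 0 := by
        rw [two_smul]; linear_combination (exp := 1) -hSv
      exact (smul_eq_zero.1 this).resolve_left h2
    rw [hb0, add_zero]; exact ha
  · rw [hJv]
    refine ⟨fun hv => by rw [hSW' v hv, smul_neg, neg_smul], fun hv => ?_⟩
    rw [neg_smul, ← smul_neg] at hv
    have hSv := smul_right_injective _ hsinv hv
    obtain ⟨a, ha, b, hb, rfl⟩ := hdec v
    rw [map_add, hSW a ha, hSW' b hb] at hSv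
    have ha0 : a = 0 := by
      have : (2 : Ω) • a = 0 := by
        rw [two_smul]; linear_combination (exp := 1) hSv
      exact (smul_eq_zero.1 this).resolve_left h2
    rw [ha0, zero_add]; exact hb

end Galois

/-! ### Matrices and linear forms over `k` acting on vectors over `K` -/

section ScalarExtension

variable {k : Type*} [Field k] (K : Type*) [Field K] [Algebra k K]
  {ι κ τ : Type*} [Fintype ι] [Fintype τ]

/-- The linear form over `K` with coefficient vector `ℓ` over `k`. -/
def extendForm (ℓ : ι → k) : (ι → K) →ₗ[K] K :=
  ∑ i, algebraMap k K (ℓ i) • LinearMap.proj i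

/-- The linear map over `K` with matrix `M` over `k`. -/
abbrev extendMatrix (M : Matrix κ ι k) : (ι → K) →ₗ[K] (κ → K) :=
  (M.map (algebraMap k K)).mulVecLin

theorem extendForm_apply (ℓ : ι → k) (v : ι → K) :
    extendForm K ℓ v = ∑ i, algebraMap k K (ℓ i) * v i := by
  simp [extendForm, Algebra.smul_def]

theorem extendMatrix_apply (M : Matrix κ ι k) (v : ι → K) (i : κ) :
    extendMatrix K M v i = ∑ j, algebraMap k K (M i j) * v j := by
  simp [Matrix.mulVec, dotProduct]

theorem extendMatrix_mul (M : Matrix κ ι k) (N : Matrix ι τ k) (v : τ → K) :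
    extendMatrix K (M * N) v = extendMatrix K M (extendMatrix K N v) := by
  simp [Matrix.map_mul]

theorem extendForm_vecMul [Fintype κ] (β : κ → k) (M : Matrix κ ι k) (v : ι → K) :
    extendForm K (Matrix.vecMul β M) v = extendForm K β (extendMatrix K M v) := by
  simp only [extendForm_apply, extendMatrix_apply, Matrix.vecMul, dotProduct, map_sum, map_mul,
    Finset.sum_mul, Finset.mul_sum]
  rw [Finset.sum_comm]
  simp only [mul_assoc]

theorem extendMatrix_algebraMap (M : Matrix κ ι k) (v : ι → k) :
    extendMatrix K M (fun i => algebraMap k K (v i)) =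
      fun i => algebraMap k K (M.mulVec v i) := by
  ext i
  simp [extendMatrix_apply, Matrix.mulVec, dotProduct]

variable {K}

theorem aeval_matrixToMvPolynomial (M : Matrix κ ι k) (v : ι → K) (i : κ) :
    aeval v (M.toMvPolynomial i) = extendMatrix K M v i := by
  simp [Matrix.toMvPolynomial, extendMatrix_apply, aeval_monomial]

theorem aeval_aeval_toMvPolynomial (M : Matrix κ ι k) (v : ι → K) (F : MvPolynomial κ k) :
    aeval v (aeval M.toMvPolynomial F) = aeval (extendMatrix K M v) F := by
  rw [comp_aeval_apply]
  congr 2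
  ext i
  exact aeval_matrixToMvPolynomial M v i

/-- The linear form with coefficient vector `ℓ`, as a polynomial. -/
noncomputable def linearForm (ℓ : ι → k) : MvPolynomial ι k :=
  ∑ i, C (ℓ i) * X i

theorem linearForm_isHomogeneous (ℓ : ι → k) : (linearForm ℓ).IsHomogeneous 1 :=
  IsHomogeneous.sum _ _ _ fun i _ => by
    simpa using (isHomogeneous_C ι (ℓ i)).mul (isHomogeneous_X k i)

theorem aeval_linearForm (ℓ : ι → k) (v : ι → K) : aeval v (linearForm ℓ) = extendForm K ℓ v := by
  simp [linearForm, extendForm_apply]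

theorem linearForm_ne_zero {ℓ : ι → k} (h : ℓ ≠ 0) : linearForm ℓ ≠ 0 := by
  classical
  obtain ⟨i, hi⟩ := Function.ne_iff.1 h
  intro h0
  have := congrArg (aeval (Pi.single i (1 : k))) h0
  rw [aeval_linearForm, map_zero, extendForm_apply] at this
  exact hi (by simpa [Pi.single_apply] using this)

end ScalarExtension

theorem isHomogeneous_aeval_toMvPolynomial {k ι : Type*} [Field k] {F : MvPolynomial ι k} {m : ℕ} (hF : F.IsHomogeneous m)
    {κ : Type*} (M : Matrix ι κ k) [Fintype κ] :
    (aeval M.toMvPolynomial F).IsHomogeneous m := by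
  simpa using hF.aeval M.toMvPolynomial (fun i => M.toMvPolynomial_isHomogeneous i)

/-! ### The residual point and the norm form as polynomials over `k` -/

section ThirdPoint

variable {k : Type*} [Field k] {K : Type*} [Field K] [Algebra k K] {ι : Type*} [Fintype ι]

/-- The polynomial map that sends `a + b`, for `a` and `b` in the two eigenspaces of `J`, to the
residual intersection of the line through `a` and `b` with the hypersurface `F = 0`. -/
noncomputable def thirdPointMap (F : MvPolynomial ι k) (J : Matrix ι ι k) (D : k) (d : ℕ) (i : ι) :
    MvPolynomial ι k :=
  C (D ^ d) * F * J.toMvPolynomial i - C ((-1) ^ d) * aeval J.toMvPolynomial F * X i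

/-- Up to a constant, the product of the values of `g` at the components of a vector in the two
eigenspaces of `J`. -/
noncomputable def normForm (J : Matrix ι ι k) (D : k) (m : ℕ) (g : MvPolynomial ι k) :
    MvPolynomial ι k :=
  C (D ^ m) * g ^ 2 - (aeval J.toMvPolynomial g) ^ 2

/-- The quadratic map that sends a vector to a combination of its components in the two eigenspaces
of `J` at which the linear form `ℓ` vanishes. -/
noncomputable def balancedMap (J : Matrix ι ι k) (ℓ : ι → k) (i : ι) : MvPolynomial ι k :=
  linearForm ℓ * J.toMvPolynomial i - aeval J.toMvPolynomial (linearForm ℓ) * X i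

theorem thirdPointMap_isHomogeneous {F : MvPolynomial ι k} {d : ℕ}
    (hF : F.IsHomogeneous (2 * d + 1)) (J : Matrix ι ι k) (D : k) (i : ι) :
    (thirdPointMap F J D d i).IsHomogeneous (2 * d + 2) := by
  refine IsHomogeneous.sub ?_ ?_
  · simpa using ((isHomogeneous_C ι (D ^ d)).mul hF).mul (J.toMvPolynomial_isHomogeneous i)
  · simpa using ((isHomogeneous_C ι ((-1 : k) ^ d)).mul
      (isHomogeneous_aeval_toMvPolynomial hF J)).mul (isHomogeneous_X k i)

theorem normForm_isHomogeneous {g : MvPolynomial ι k} {e : ℕ} (hg : g.IsHomogeneous e)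
    (J : Matrix ι ι k) (D : k) (m : ℕ) : (normForm J D m g).IsHomogeneous (e * 2) := by
  refine IsHomogeneous.sub ?_ ?_
  · simpa using (isHomogeneous_C ι (D ^ m)).mul (hg.pow 2)
  · simpa using (isHomogeneous_aeval_toMvPolynomial hg J).pow 2

theorem balancedMap_isHomogeneous (J : Matrix ι ι k) (ℓ : ι → k) (i : ι) :
    (balancedMap J ℓ i).IsHomogeneous 2 :=
  ((linearForm_isHomogeneous ℓ).mul (J.toMvPolynomial_isHomogeneous i)).sub
    ((isHomogeneous_aeval_toMvPolynomial (linearForm_isHomogeneous ℓ) J).mul (isHomogeneous_X k i))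

theorem aeval_thirdPointMap (F : MvPolynomial ι k) (J : Matrix ι ι k) (D : k) (d : ℕ) (v : ι → K) :
    (fun i => aeval v (thirdPointMap F J D d i)) =
      (algebraMap k K D ^ d * aeval v F) • extendMatrix K J v -
        ((-1) ^ d * aeval (extendMatrix K J v) F) • v := by
  ext i
  simp only [thirdPointMap, map_sub, map_mul, map_pow, aeval_C, aeval_X, map_neg, map_one, Pi.sub_apply,
    Pi.smul_apply, smul_eq_mul, aeval_matrixToMvPolynomial, aeval_aeval_toMvPolynomial]

theorem aeval_normForm (J : Matrix ι ι k) (D : k) (m : ℕ) (g : MvPolynomial ι k) (v : ι → K) :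
    aeval v (normForm J D m g) =
      algebraMap k K D ^ m * aeval v g ^ 2 - aeval (extendMatrix K J v) g ^ 2 := by
  simp only [normForm, map_sub, map_mul, map_pow, aeval_C, aeval_aeval_toMvPolynomial]

theorem aeval_balancedMap (J : Matrix ι ι k) (ℓ : ι → k) (v : ι → K) :
    (fun i => aeval v (balancedMap J ℓ i)) =
      extendForm K ℓ v • extendMatrix K J v - extendForm K ℓ (extendMatrix K J v) • v := by
  ext i
  simp only [balancedMap, map_sub, map_mul, aeval_X, Pi.sub_apply,
    Pi.smul_apply, smul_eq_mul, aeval_matrixToMvPolynomial, aeval_aeval_toMvPolynomial, aeval_linearForm]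

/-- The exponent of `D` is odd: a zero would read `D = (g(Jv) / (D^d g(v)))²` in `k`. -/
theorem aeval_normForm_ne_zero_of_rational {J : Matrix ι ι k} {D : k} (hD : ¬ IsSquare D) (d : ℕ)
    {g : MvPolynomial ι k} {v : ι → k} (hg : aeval (fun i => algebraMap k K (v i)) g ≠ 0) :
    aeval (fun i => algebraMap k K (v i)) (normForm J D (2 * d + 1) g) ≠ 0 := by
  have hval : ∀ (w : ι → k) (h : MvPolynomial ι k),
      aeval (fun i => algebraMap k K (w i)) h = algebraMap k K (aeval w h) := fun w h =>
    aeval_algebraMap_apply K w h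
  rw [aeval_normForm, extendMatrix_algebraMap, hval, hval, ← map_pow (algebraMap k K),
    ← map_pow (algebraMap k K), ← map_pow (algebraMap k K), ← map_mul (algebraMap k K),
    ← map_sub (algebraMap k K)]
  rw [hval] at hg
  have hg' : aeval v g ≠ 0 := fun h0 => hg (by rw [h0, map_zero])
  intro h0
  have h1 := (map_eq_zero _).1 h0
  have hD0 : D ≠ 0 := by
    rintro rfl
    exact hD ⟨0, by simp⟩
  refine hD ⟨aeval (J.mulVec v) g / (D ^ d * aeval v g), ?_⟩
  field_simp
  linear_combination h1

section Eigenvectors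

variable {J : Matrix ι ι k} {D : k} {δ : K} {a b : ι → K}

theorem extendMatrix_smul_add_smul (ha : extendMatrix K J a = δ • a)
    (hb : extendMatrix K J b = (-δ) • b) (s t : K) :
    extendMatrix K J (s • a + t • b) = δ • (s • a + (-t) • b) := by
  rw [map_add, map_smul, map_smul, ha, hb]
  module

/-- Applying `J` replaces `t` by `-t` up to the scalar `δ`, so what remains is `(sP + tQ)² - (sP -
tQ)² = 4stPQ`. -/
theorem aeval_normForm_smul_add_smul (hδ : δ ^ 2 = algebraMap k K D)
    (ha : extendMatrix K J a = δ • a) (hb : extendMatrix K J b = (-δ) • b)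
    {g : MvPolynomial ι k} {d : ℕ} (hg : g.IsHomogeneous (2 * d + 1)) {P Q : K}
    (hPQ : ∀ s t : K, aeval (s • a + t • b) g = s ^ d * t ^ d * (s * P + t * Q)) (s t : K) :
    aeval (s • a + t • b) (normForm J D (2 * d + 1) g) =
      4 * algebraMap k K D ^ (2 * d + 1) * (s * t) ^ (2 * d + 1) * (P * Q) := by
  rw [aeval_normForm, extendMatrix_smul_add_smul ha hb, aeval_smul_of_isHomogeneous hg, hPQ, hPQ,
    ← hδ]
  have h1 : ((-1 : K) ^ d) ^ 2 = 1 := by rw [← pow_mul, mul_comm, pow_mul]; simp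
  rw [neg_pow t d]
  linear_combination (-(δ ^ (2 * d + 1)) ^ 2 * (s ^ d * t ^ d) ^ 2 * (s * P - t * Q) ^ 2) * h1

/-- The combination is chosen so that in `(sP + tQ)(sa - tb) - (sP - tQ)(sa + tb)` only `2st(Qa -
Pb)` survives; this is the zero of `sP + tQ` on the line. -/
theorem aeval_thirdPointMap_smul_add_smul (hδ : δ ^ 2 = algebraMap k K D)
    (ha : extendMatrix K J a = δ • a) (hb : extendMatrix K J b = (-δ) • b)
    {F : MvPolynomial ι k} {d : ℕ} (hF : F.IsHomogeneous (2 * d + 1)) {P Q : K}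
    (hPQ : ∀ s t : K, aeval (s • a + t • b) F = s ^ d * t ^ d * (s * P + t * Q)) (s t : K) :
    (fun i => aeval (s • a + t • b) (thirdPointMap F J D d i)) =
      (2 * δ ^ (2 * d + 1) * (s * t) ^ (d + 1)) • (Q • a - P • b) := by
  rw [aeval_thirdPointMap, extendMatrix_smul_add_smul ha hb, aeval_smul_of_isHomogeneous hF, hPQ,
    hPQ, ← hδ]
  have h1 : (-1 : K) ^ d * (-1 : K) ^ d = 1 := by rw [← mul_pow]; simp
  rw [neg_pow t d, show (-1 : K) ^ d * (δ ^ (2 * d + 1) *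
    (s ^ d * ((-1) ^ d * t ^ d) * (s * P + -t * Q))) =
    ((-1 : K) ^ d * (-1 : K) ^ d) * δ ^ (2 * d + 1) * (s * t) ^ d * (s * P - t * Q) by
      rw [mul_pow]; ring, h1, ← pow_mul, mul_pow s t (d + 1)]
  module

theorem aeval_linearForm_smul_add_smul (ℓ : ι → k) (s t : K) :
    aeval (s • a + t • b) (linearForm ℓ) =
      s ^ 0 * t ^ 0 * (s * extendForm K ℓ a + t * extendForm K ℓ b) := by
  simp [aeval_linearForm]

theorem aeval_balancedMap_smul_add_smul (ha : extendMatrix K J a = δ • a)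
    (hb : extendMatrix K J b = (-δ) • b) (ℓ : ι → k) (s t : K) :
    (fun i => aeval (s • a + t • b) (balancedMap J ℓ i)) =
      (s * t) • ((2 * δ * extendForm K ℓ b) • a + (-(2 * δ * extendForm K ℓ a)) • b) := by
  rw [aeval_balancedMap, extendMatrix_smul_add_smul ha hb]
  simp only [map_add, map_smul, smul_eq_mul]
  module

end Eigenvectors

end ThirdPoint

/-! ### Scaling the two components independently -/

section Twist

variable {k : Type*} [Field k] {K : Type*} [Field K] [Algebra k K] {ι : Type*} [Fintype ι]

/-- The vector `w` arises from `v` by scaling each of its two components in the eigenspaces of `J`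
by a nonzero factor. -/
def IsTwist (J : Matrix ι ι k) (δ : K) (v w : ι → K) : Prop :=
  ∃ (a b : ι → K) (s t : K), extendMatrix K J a = δ • a ∧ extendMatrix K J b = (-δ) • b ∧
    s ≠ 0 ∧ t ≠ 0 ∧ v = a + b ∧ w = s • a + t • b

/-- On each line that meets both eigenspaces of `J`, the form `g` is the product of a linear form
and the `e`-th power of the equation of the two points of intersection. -/
def IsSplitForm (J : Matrix ι ι k) (δ : K) (e : ℕ) (g : MvPolynomial ι k) : Prop :=
  ∀ a b : ι → K, extendMatrix K J a = δ • a → extendMatrix K J b = (-δ) • b →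
    ∃ P Q : K, ∀ s t : K, aeval (s • a + t • b) g = s ^ e * t ^ e * (s * P + t * Q)

variable {J : Matrix ι ι k} {D : k} {δ : K} {F : MvPolynomial ι k} {d : ℕ} {v w : ι → K}

/-- A hyperplane is the case `e = 0` of the hypersurfaces considered, so whatever is proved for
split forms applies to both. -/
theorem isSplitForm_linearForm (J : Matrix ι ι k) (δ : K) (ℓ : ι → k) :
    IsSplitForm J δ 0 (linearForm ℓ) :=
  fun _ _ _ _ => ⟨_, _, aeval_linearForm_smul_add_smul ℓ⟩

theorem ne_zero_of_not_isSquare (hD : ¬ IsSquare D) (hδ : δ ^ 2 = algebraMap k K D) : δ ≠ 0 := by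
  rintro rfl
  rw [zero_pow two_ne_zero, eq_comm, map_eq_zero] at hδ
  exact hD ⟨0, by rw [hδ, mul_zero]⟩

theorem extendMatrix_extendMatrix [DecidableEq ι] (hJ : J * J = D • 1) (v : ι → K) :
    extendMatrix K J (extendMatrix K J v) = algebraMap k K D • v := by
  rw [← extendMatrix_mul, hJ]
  ext i
  rw [extendMatrix_apply, Finset.sum_eq_single i]
  · simp
  · intro j _ hj
    simp [Matrix.one_apply_ne' hj]
  · simp

theorem exists_eigenvectors [DecidableEq ι] [CharZero K] (hD : ¬ IsSquare D)
    (hδ : δ ^ 2 = algebraMap k K D)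
    (hJ : J * J = D • 1) (v : ι → K) :
    ∃ a b : ι → K, extendMatrix K J a = δ • a ∧ extendMatrix K J b = (-δ) • b ∧ v = a + b := by
  have hδ0 := ne_zero_of_not_isSquare hD hδ
  refine ⟨(2⁻¹ : K) • (v + δ⁻¹ • extendMatrix K J v), (2⁻¹ : K) • (v - δ⁻¹ • extendMatrix K J v),
    ?_, ?_, ?_⟩
  · simp only [map_smul, map_add, extendMatrix_extendMatrix hJ, ← hδ]
    match_scalars <;> field_simp
  · simp only [map_smul, map_sub, extendMatrix_extendMatrix hJ, ← hδ]
    match_scalars <;> field_simp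
  · match_scalars <;> field_simp <;> norm_num

/-- If `sa + tb = 0`, applying `J` gives `sa - tb = 0` as well, so both components vanish. -/
theorem IsTwist.ne_zero [CharZero K] (hδ0 : δ ≠ 0) (h : IsTwist J δ v w) (hv : v ≠ 0) : w ≠ 0 := by
  obtain ⟨a, b, s, t, ha, hb, hs, ht, rfl, rfl⟩ := h
  intro h0
  have h1 := extendMatrix_smul_add_smul ha hb s t
  rw [h0, map_zero, eq_comm, smul_eq_zero_iff_right hδ0] at h1
  have hsa : (2 * s) • a = 0 := by
    rw [← add_zero (0 : ι → K)]
    nth_rw 1 [← h0]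
    rw [← h1]
    module
  have htb : (2 * t) • b = 0 := by
    rw [← sub_zero (0 : ι → K)]
    nth_rw 1 [← h0]
    rw [← h1]
    module
  rw [smul_eq_zero_iff_right (mul_ne_zero two_ne_zero hs)] at hsa
  rw [smul_eq_zero_iff_right (mul_ne_zero two_ne_zero ht)] at htb
  exact hv (by rw [hsa, htb, add_zero])

theorem isTwist_extendMatrix [DecidableEq ι] [CharZero K] (hD : ¬ IsSquare D)
    (hδ : δ ^ 2 = algebraMap k K D) (hJ : J * J = D • 1) (v : ι → K) :
    IsTwist J δ v (extendMatrix K J v) := by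
  have hδ0 := ne_zero_of_not_isSquare hD hδ
  obtain ⟨a, b, ha, hb, rfl⟩ := exists_eigenvectors hD hδ hJ v
  exact ⟨a, b, δ, -δ, ha, hb, hδ0, neg_ne_zero.2 hδ0, rfl, by rw [map_add, ha, hb]⟩

theorem IsTwist.aeval_normForm_ne_zero (hδ : δ ^ 2 = algebraMap k K D) {g : MvPolynomial ι k}
    {e : ℕ} (hg : g.IsHomogeneous (2 * e + 1)) (hsplit : IsSplitForm J δ e g)
    (h : IsTwist J δ v w) (hv : aeval v (normForm J D (2 * e + 1) g) ≠ 0) :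
    aeval w (normForm J D (2 * e + 1) g) ≠ 0 := by
  obtain ⟨a, b, s, t, ha, hb, hs, ht, rfl, rfl⟩ := h
  obtain ⟨P, Q, hPQ⟩ := hsplit a b ha hb
  have h1 := aeval_normForm_smul_add_smul hδ ha hb hg hPQ 1 1
  rw [one_smul, one_smul] at h1
  rw [h1] at hv
  rw [aeval_normForm_smul_add_smul hδ ha hb hg hPQ]
  simp only [mul_one, one_pow, ne_eq, mul_eq_zero, not_or] at hv ⊢
  exact ⟨⟨hv.1, pow_ne_zero _ (mul_ne_zero hs ht)⟩, hv.2⟩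

/-- A twist does not change the points `a` and `b`, hence not their line nor its residual point. -/
theorem IsTwist.thirdPointMap (hδ : δ ^ 2 = algebraMap k K D) (hF : F.IsHomogeneous (2 * d + 1))
    (hsplit : IsSplitForm J δ d F) (h : IsTwist J δ v w) :
    ∃ c : K, c ≠ 0 ∧ (fun i => aeval w (thirdPointMap F J D d i)) =
      c • fun i => aeval v (thirdPointMap F J D d i) := by
  obtain ⟨a, b, s, t, ha, hb, hs, ht, rfl, rfl⟩ := h
  obtain ⟨P, Q, hPQ⟩ := hsplit a b ha hb
  have h1 := aeval_thirdPointMap_smul_add_smul hδ ha hb hF hPQ 1 1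
  rw [one_smul, one_smul] at h1
  refine ⟨(s * t) ^ (d + 1), pow_ne_zero _ (mul_ne_zero hs ht), ?_⟩
  rw [h1, aeval_thirdPointMap_smul_add_smul hδ ha hb hF hPQ, smul_smul]
  congr 1
  ring

theorem IsTwist.balancedMap (ℓ : ι → k) (h : IsTwist J δ v w) :
    ∃ c : K, c ≠ 0 ∧ (fun i => aeval w (balancedMap J ℓ i)) =
      c • fun i => aeval v (balancedMap J ℓ i) := by
  obtain ⟨a, b, s, t, ha, hb, hs, ht, rfl, rfl⟩ := h
  have h1 := aeval_balancedMap_smul_add_smul ha hb ℓ 1 1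
  rw [one_smul, one_smul] at h1
  refine ⟨s * t, mul_ne_zero hs ht, ?_⟩
  rw [h1, aeval_balancedMap_smul_add_smul ha hb]
  simp only [mul_one, one_smul]

theorem isTwist_thirdPointMap [DecidableEq ι] [CharZero K] (hD : ¬ IsSquare D)
    (hδ : δ ^ 2 = algebraMap k K D) (hJ : J * J = D • 1) (hF : F.IsHomogeneous (2 * d + 1))
    (hsplit : IsSplitForm J δ d F) (hv : aeval v (normForm J D (2 * d + 1) F) ≠ 0) :
    IsTwist J δ v (fun i => aeval v (thirdPointMap F J D d i)) := by
  have hδ0 := ne_zero_of_not_isSquare hD hδ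
  obtain ⟨a, b, ha, hb, rfl⟩ := exists_eigenvectors hD hδ hJ v
  obtain ⟨P, Q, hPQ⟩ := hsplit a b ha hb
  have h1 := aeval_thirdPointMap_smul_add_smul hδ ha hb hF hPQ 1 1
  have h2 := aeval_normForm_smul_add_smul hδ ha hb hF hPQ 1 1
  rw [one_smul, one_smul] at h1 h2
  rw [h2] at hv
  simp only [mul_one, one_pow, ne_eq, mul_eq_zero, not_or] at hv
  have hc : 2 * δ ^ (2 * d + 1) * (1 * 1) ^ (d + 1) ≠ 0 := by simp [hδ0]
  refine ⟨a, b, _, _, ha, hb, mul_ne_zero hc hv.2.2, neg_ne_zero.2 (mul_ne_zero hc hv.2.1), rfl, ?_⟩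
  rw [h1]
  module

theorem aeval_thirdPointMap_eq_zero [DecidableEq ι] [CharZero K] (hD : ¬ IsSquare D)
    (hδ : δ ^ 2 = algebraMap k K D) (hJ : J * J = D • 1) (hF : F.IsHomogeneous (2 * d + 1))
    (hsplit : IsSplitForm J δ d F) (v : ι → K) :
    aeval (fun i => aeval v (thirdPointMap F J D d i)) F = 0 := by
  obtain ⟨a, b, ha, hb, rfl⟩ := exists_eigenvectors hD hδ hJ v
  obtain ⟨P, Q, hPQ⟩ := hsplit a b ha hb
  have h1 := aeval_thirdPointMap_smul_add_smul hδ ha hb hF hPQ 1 1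
  rw [one_smul, one_smul] at h1
  rw [h1, aeval_smul_of_isHomogeneous hF, sub_eq_add_neg, ← neg_smul, hPQ]
  ring

/-- On `X` the term with `F(v)` drops out and a multiple of `v` is left; the norm form makes its
coefficient nonzero. -/
theorem exists_thirdPointMap_eq_smul {J : Matrix ι ι k} {D : k}
    (hFv : aeval v F = 0) (hv : aeval v (normForm J D (2 * d + 1) F) ≠ 0) :
    ∃ c : K, c ≠ 0 ∧ (fun i => aeval v (thirdPointMap F J D d i)) = c • v := by
  rw [aeval_normForm, hFv] at hv
  refine ⟨-((-1) ^ d * aeval (extendMatrix K J v) F), ?_, ?_⟩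
  · refine neg_ne_zero.2 (mul_ne_zero (pow_ne_zero _ (by simp)) fun h0 => hv (by rw [h0]; simp))
  · rw [aeval_thirdPointMap, hFv, mul_zero, zero_smul, zero_sub, neg_smul]

theorem isTwist_balancedMap [DecidableEq ι] [CharZero K] (hD : ¬ IsSquare D)
    (hδ : δ ^ 2 = algebraMap k K D) (hJ : J * J = D • 1) (ℓ : ι → k)
    (hv : aeval v (normForm J D (2 * 0 + 1) (linearForm ℓ)) ≠ 0) :
    IsTwist J δ v (fun i => aeval v (balancedMap J ℓ i)) := by
  have hδ0 := ne_zero_of_not_isSquare hD hδ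
  obtain ⟨a, b, ha, hb, rfl⟩ := exists_eigenvectors hD hδ hJ v
  have h1 := aeval_balancedMap_smul_add_smul ha hb ℓ 1 1
  have h2 := aeval_normForm_smul_add_smul (d := 0) hδ ha hb (linearForm_isHomogeneous ℓ)
    (aeval_linearForm_smul_add_smul ℓ) 1 1
  rw [one_smul, one_smul] at h1 h2
  rw [h2] at hv
  simp only [mul_one, one_pow, ne_eq, mul_eq_zero, not_or] at hv
  have hc : 2 * δ ≠ 0 := by simp [hδ0]
  refine ⟨a, b, _, _, ha, hb, mul_ne_zero hc hv.2.2, neg_ne_zero.2 (mul_ne_zero hc hv.2.1), rfl, ?_⟩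
  rw [h1, mul_one, one_smul]

theorem extendForm_balancedMap (J : Matrix ι ι k) (ℓ : ι → k) (v : ι → K) :
    extendForm K ℓ (fun i => aeval v (balancedMap J ℓ i)) = 0 := by
  rw [aeval_balancedMap, map_sub, map_smul, map_smul, smul_eq_mul, smul_eq_mul]
  ring

theorem extendForm_extendMatrix_balancedMap [DecidableEq ι] (hJ : J * J = D • 1) (ℓ : ι → k)
    (v : ι → K) :
    extendForm K ℓ (extendMatrix K J (fun i => aeval v (balancedMap J ℓ i))) =
      aeval v (normForm J D (2 * 0 + 1) (linearForm ℓ)) := by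
  rw [aeval_balancedMap, map_sub, map_smul, map_smul, extendMatrix_extendMatrix hJ, aeval_normForm,
    map_sub, map_smul, map_smul, map_smul, aeval_linearForm, aeval_linearForm]
  simp only [smul_eq_mul]
  ring

theorem ne_zero_of_aeval_normForm_ne_zero {g : MvPolynomial ι k} {e m : ℕ}
    (hg : g.IsHomogeneous (e + 1)) (hv : aeval v (normForm J D m g) ≠ 0) : v ≠ 0 := by
  rintro rfl
  have := aeval_smul_of_isHomogeneous (normForm_isHomogeneous hg J D m) (0 : K) (0 : ι → K)
  rw [zero_smul, zero_pow (by omega), zero_mul] at this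
  exact hv this

/-- There is a vector at which neither the norm form of `F` nor that of `ℓ` vanishes. -/
theorem exists_aeval_normForm_ne_zero [CharZero k] (hD : ¬ IsSquare D)
    (hF0 : F ≠ 0) {ℓ : ι → k} (hℓ : ℓ ≠ 0) :
    ∃ v : ι → K, aeval v (normForm J D (2 * d + 1) F) ≠ 0 ∧
      aeval v (normForm J D (2 * 0 + 1) (linearForm ℓ)) ≠ 0 := by
  obtain ⟨v, hv⟩ := exists_aeval_ne_zero (K := K) (mul_ne_zero hF0 (linearForm_ne_zero hℓ))
  rw [map_mul] at hv
  exact ⟨_, aeval_normForm_ne_zero_of_rational hD d (left_ne_zero_of_mul hv),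
    aeval_normForm_ne_zero_of_rational hD 0 (right_ne_zero_of_mul hv)⟩

end Twist

/-! ### Rationality: the hypersurface and a hyperplane as slices of the twist classes -/

section Rationality

variable {k : Type*} [Field k] [CharZero k]

local notation "Ω" => AlgebraicClosure k

/-- A property that holds where the norm forms of `F` and of `ℓ` do not vanish is generic on the
hypersurface `F = 0`. -/
theorem genericallyOn_hypersurface_of_normForm {ι : Type*} [Fintype ι] [DecidableEq ι]
    {J : Matrix ι ι k} {D : k} {δ : Ω} {F : MvPolynomial ι k} {d : ℕ} (hD : ¬ IsSquare D)
    (hδ : δ ^ 2 = algebraMap k Ω D) (hJ : J * J = D • 1) (hF : F.IsHomogeneous (2 * d + 1))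
    (hFirr : Irreducible F) (hsplit : IsSplitForm J δ d F) {ℓ : ι → k} (hℓ : ℓ ≠ 0)
    {P : PPoint k ι → Prop}
    (hP : ∀ (v : ι → Ω) (hv : v ≠ 0), aeval v F = 0 → aeval v (normForm J D (2 * d + 1) F) ≠ 0 →
      aeval v (normForm J D (2 * 0 + 1) (linearForm ℓ)) ≠ 0 → P (Projectivization.mk Ω v hv)) :
    GenericallyOn (hypersurface F) P := by
  have : CharZero Ω := algebraRat.charZero _
  obtain ⟨v, hv1, hv2⟩ := exists_aeval_normForm_ne_zero (K := Ω) (J := J) (d := d) hD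
    hFirr.ne_zero hℓ
  -- Nonemptiness on `X`: the residual point of `v` lies on `X` and, as a twist of `v`, keeps both
  -- norm forms nonzero.
  have htw := isTwist_thirdPointMap hD hδ hJ hF hsplit hv1
  have hv0 := ne_zero_of_aeval_normForm_ne_zero hF hv1
  refine genericallyOn_hypersurface hF hFirr
    ((normForm_isHomogeneous hF J D (2 * d + 1)).mul
      (normForm_isHomogeneous (linearForm_isHomogeneous ℓ) J D (2 * 0 + 1)))
    (htw.ne_zero (ne_zero_of_not_isSquare hD hδ) hv0)
    (aeval_thirdPointMap_eq_zero hD hδ hJ hF hsplit v) ?_ fun w hw hFw hqw => ?_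
  · rw [map_mul]
    exact mul_ne_zero (htw.aeval_normForm_ne_zero hδ hF hsplit hv1)
      (htw.aeval_normForm_ne_zero hδ (linearForm_isHomogeneous ℓ) (isSplitForm_linearForm J δ ℓ) hv2)
  · rw [map_mul] at hqw
    exact hP w hw hFw (left_ne_zero_of_mul hqw) (right_ne_zero_of_mul hqw)

theorem isRationalOver_hypersurface {m d : ℕ} {F : MvPolynomial (Fin (m + 2)) k}
    {J : Matrix (Fin (m + 2)) (Fin (m + 2)) k} {D : k} {δ : Ω} (hD : ¬ IsSquare D)
    (hδ : δ ^ 2 = algebraMap k Ω D) (hJ : J * J = D • 1) (hF : F.IsHomogeneous (2 * d + 1))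
    (hFirr : Irreducible F) (hsplit : IsSplitForm J δ d F) :
    IsRationalOver m (hypersurface F) := by
  have : CharZero Ω := algebraRat.charZero _
  have hδ0 := ne_zero_of_not_isSquare hD hδ
  -- The hyperplane is `x₀ = 0`, a copy of projective `m`-space embedded by `inc`. Then `f` is the
  -- residual point map restricted to it, and `g` omits the zero coordinate of `balancedMap`.
  let ℓ : Fin (m + 2) → k := Pi.single 0 1
  have hℓ0 : ℓ ≠ 0 := by simp [ℓ]
  have hℓ : ∀ v : Fin (m + 2) → Ω, extendForm Ω ℓ v = v 0 := fun v => by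
    simp [ℓ, extendForm_apply, Pi.single_apply]
  let inc : Fin (m + 2) → MvPolynomial (Fin (m + 1)) k := Fin.cons 0 X
  have hinc : ∀ i, (inc i).IsHomogeneous 1 := fun i => by
    refine Fin.cases ?_ (fun j => ?_) i
    · exact isHomogeneous_zero _ _ _
    · exact isHomogeneous_X _ _
  have hev : ∀ (y : Fin (m + 1) → Ω) (p : MvPolynomial (Fin (m + 2)) k),
      aeval y (aeval inc p) = aeval (Fin.cons 0 y : Fin (m + 2) → Ω) p := fun y p => by
    rw [comp_aeval_apply]
    congr 2
    ext i
    refine Fin.cases ?_ (fun j => ?_) i <;> simp [inc]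
  have hcons : ∀ v : Fin (m + 2) → Ω,
      (Fin.cons 0 (fun j => aeval v (balancedMap J ℓ (Fin.succ j))) : Fin (m + 2) → Ω) =
        fun i => aeval v (balancedMap J ℓ i) := fun v => by
    ext i
    refine Fin.cases ?_ (fun j => ?_) i
    · exact (extendForm_balancedMap J ℓ v).symm.trans (hℓ _)
    · simp
  let f : Fin (m + 2) → MvPolynomial (Fin (m + 1)) k := fun i => aeval inc (thirdPointMap F J D d i)
  let g : Fin (m + 1) → MvPolynomial (Fin (m + 2)) k := fun j => balancedMap J ℓ j.succ
  have hf : ∀ i, (f i).IsHomogeneous (2 * d + 2) := fun i => by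
    have := (thirdPointMap_isHomogeneous hF J D i).aeval inc hinc
    rwa [one_mul] at this
  have hg : ∀ j, (g j).IsHomogeneous 2 := fun j => balancedMap_isHomogeneous J ℓ j.succ
  have hfev : ∀ y : Fin (m + 1) → Ω, (fun i => aeval y (f i)) =
      fun i => aeval (Fin.cons 0 y : Fin (m + 2) → Ω) (thirdPointMap F J D d i) := fun y =>
    _root_.funext fun i => hev y _
  refine ⟨f, g, ⟨_, hf⟩, ⟨_, hg⟩, ?_, ?_⟩
  -- On `ℓ = 0` the balanced map is `y ↦ -ℓ(Jy) y`, so besides the norm form of `F` only `ℓ(Jy)`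
  -- must be nonzero.
  · have hq := ((normForm_isHomogeneous hF J D (2 * d + 1)).mul
      (isHomogeneous_aeval_toMvPolynomial (linearForm_isHomogeneous ℓ) J)).aeval inc hinc
    obtain ⟨v, hv1, hv2⟩ := exists_aeval_normForm_ne_zero (K := Ω) (J := J) (d := d) hD
      hFirr.ne_zero hℓ0
    have htw := isTwist_balancedMap hD hδ hJ ℓ hv2
    have hwne := htw.ne_zero hδ0 (ne_zero_of_aeval_normForm_ne_zero hF hv1)
    refine genericallyOn_of_parametrization X
      (fun x _ => ⟨x.rep, by simpa using x.rep_nonzero, by simp⟩)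
      (fun _ _ => Set.mem_univ _) hq
      (t₀ := fun j => aeval v (balancedMap J ℓ j.succ)) ?_ ?_ ?_
    · simp only [aeval_X]
      intro h0
      refine hwne ?_
      rw [← hcons v, show (fun j : Fin (m + 1) => aeval v (balancedMap J ℓ j.succ)) = 0 from h0]
      ext i
      refine Fin.cases ?_ (fun j => ?_) i <;> simp
    · simp only [aeval_X]
      rw [hev, hcons, map_mul, aeval_aeval_toMvPolynomial, aeval_linearForm,
        extendForm_extendMatrix_balancedMap hJ]
      exact mul_ne_zero (htw.aeval_normForm_ne_zero hδ hF hsplit hv1) hv2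
    · intro y hy hqy
      simp only [aeval_X] at hy hqy ⊢
      rw [hev, map_mul, aeval_aeval_toMvPolynomial, aeval_linearForm] at hqy
      have h1 := left_ne_zero_of_mul hqy
      have h2 := right_ne_zero_of_mul hqy
      have htw' := isTwist_thirdPointMap hD hδ hJ hF hsplit h1
      have hne := htw'.ne_zero hδ0 (ne_zero_of_aeval_normForm_ne_zero hF h1)
      refine ⟨Projectivization.mk Ω _ hne, (mem_hypersurface_mk hF hne).2
        (aeval_thirdPointMap_eq_zero hD hδ hJ hF hsplit _), ?_, ?_⟩
      · exact sendsTo_mk hf hy hne one_ne_zero (by rw [hfev, one_smul])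
      · obtain ⟨c, hc, hcG⟩ := htw'.balancedMap ℓ
        refine sendsTo_mk hg hne hy (mul_ne_zero hc (neg_ne_zero.2 h2)) ?_
        ext j
        have := congrFun hcG j.succ
        rw [aeval_balancedMap J ℓ (Fin.cons 0 y), hℓ, Fin.cons_zero, zero_smul, zero_sub] at this
        simpa [mul_assoc] using this
  · refine genericallyOn_hypersurface_of_normForm hD hδ hJ hF hFirr hsplit hℓ0
      fun x hx hFx h1 h2 => ?_
    have htw := isTwist_balancedMap hD hδ hJ ℓ h2
    have hwne := htw.ne_zero hδ0 hx
    have hy : (fun j => aeval x (g j)) ≠ 0 := by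
      intro h0
      refine hwne ?_
      rw [← hcons x, show (fun j : Fin (m + 1) => aeval x (balancedMap J ℓ j.succ)) = 0 from h0]
      ext i
      refine Fin.cases ?_ (fun j => ?_) i <;> simp
    obtain ⟨c, hc, hcT⟩ := htw.thirdPointMap hδ hF hsplit
    obtain ⟨c', hc', hcT'⟩ := exists_thirdPointMap_eq_smul (J := J) (D := D) (d := d) hFx h1
    refine ⟨Projectivization.mk Ω _ hy, Set.mem_univ _,
      sendsTo_mk hg hx hy one_ne_zero (one_smul _ _).symm,
      sendsTo_mk hf hy hx (mul_ne_zero hc hc') ?_⟩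
    rw [hfev, show (Fin.cons 0 (fun j => aeval x (g j)) : Fin (m + 2) → Ω) = _ from hcons x, hcT,
      hcT', smul_smul]

end Rationality

/-! ### Plücker coordinates and contractions -/

section Plucker

variable {k : Type*} [Field k] {K : Type*} [Field K] [Algebra k K] {m : ℕ}

/-- The Plücker vector of two vectors. -/
def plucker (u w : Fin m → K) : PluckerIndex m → K :=
  fun s => u s.1.1 * w s.1.2 - u s.1.2 * w s.1.1

/-- The antisymmetric extension of the Plücker coordinates to all pairs of indices. -/
noncomputable def pluckerCoord (k : Type*) [Field k] (j l : Fin m) :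
    MvPolynomial (PluckerIndex m) k :=
  if h : j < l then X ⟨(j, l), h⟩ else if h : l < j then -X ⟨(l, j), h⟩ else 0

theorem pluckerCoord_isHomogeneous (j l : Fin m) : (pluckerCoord k j l).IsHomogeneous 1 := by
  unfold pluckerCoord
  split_ifs
  · exact isHomogeneous_X _ _
  · exact (isHomogeneous_X _ _).neg
  · exact isHomogeneous_zero _ _ _

theorem aeval_pluckerCoord (u w : Fin m → K) (j l : Fin m) :
    aeval (plucker u w) (pluckerCoord k j l) = u j * w l - u l * w j := by
  unfold pluckerCoord
  split_ifs with h1 h2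
  · simp [plucker]
  · simp [plucker]
  · obtain rfl : j = l := le_antisymm (not_lt.1 h2) (not_lt.1 h1)
    simp

theorem plucker_combination (x y z t : K) (u w : Fin m → K) :
    plucker (x • u + y • w) (z • u + t • w) = (x * t - y * z) • plucker u w := by
  ext s
  simp [plucker]
  ring

/-- The contraction of a Plücker vector with a linear form. -/
noncomputable def contraction (φ : Fin m → k) (j : Fin m) : MvPolynomial (PluckerIndex m) k :=
  ∑ l, C (φ l) * pluckerCoord k j l

theorem contraction_isHomogeneous (φ : Fin m → k) (j : Fin m) :
    (contraction φ j).IsHomogeneous 1 :=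
  IsHomogeneous.sum _ _ _ fun l _ => by
    simpa using (isHomogeneous_C _ (φ l)).mul (pluckerCoord_isHomogeneous j l)

/-- The result is the point at which the line spanned by `u` and `w` meets the hyperplane `φ = 0`,
if the line is not contained in it. -/
theorem aeval_contraction (φ : Fin m → k) (u w : Fin m → K) :
    (fun j => aeval (plucker u w) (contraction φ j)) =
      extendForm K φ w • u - extendForm K φ u • w := by
  ext j
  simp only [contraction, map_sum, map_mul, aeval_C, aeval_pluckerCoord, extendForm_apply,
    Pi.sub_apply, Pi.smul_apply, smul_eq_mul, Finset.sum_mul, ← Finset.sum_sub_distrib]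
  exact Finset.sum_congr rfl fun l _ => by ring

/-- The value of the exterior product of two linear forms on a Plücker vector. -/
noncomputable def wedgeForm (φ ψ : Fin m → k) : MvPolynomial (PluckerIndex m) k :=
  ∑ j, C (φ j) * contraction ψ j

theorem wedgeForm_isHomogeneous (φ ψ : Fin m → k) : (wedgeForm φ ψ).IsHomogeneous 1 :=
  IsHomogeneous.sum _ _ _ fun j _ => by
    simpa using (isHomogeneous_C _ (φ j)).mul (contraction_isHomogeneous ψ j)

theorem aeval_wedgeForm (φ ψ : Fin m → k) (u w : Fin m → K) :
    aeval (plucker u w) (wedgeForm φ ψ) =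
      extendForm K φ u * extendForm K ψ w - extendForm K φ w * extendForm K ψ u := by
  have h : aeval (plucker u w) (wedgeForm φ ψ) =
      extendForm K φ (fun j => aeval (plucker u w) (contraction ψ j)) := by
    simp [wedgeForm, extendForm_apply]
  rw [h, aeval_contraction, map_sub, map_smul, map_smul, smul_eq_mul, smul_eq_mul]
  ring

end Plucker

/-! ### Dense open subsets of the Grassmannian -/

section Grassmannian

variable {k : Type*} [Field k] {m : ℕ}

local notation "Ω" => AlgebraicClosure k

theorem mk_plucker_mem {u w : Fin m → Ω} (h : plucker u w ≠ 0) :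
    Projectivization.mk Ω _ h ∈ grassmannianOfLines k m :=
  ⟨_, u, w, rfl, h, rfl⟩

/-- A nonempty open subset of the Grassmannian of lines is dense. -/
theorem genericallyOn_grassmannianOfLines [CharZero k] {q : MvPolynomial (PluckerIndex m) k} {e : ℕ}
    (hq : q.IsHomogeneous e) {u₀ w₀ : Fin m → Ω} (h₀ : plucker u₀ w₀ ≠ 0)
    (hq₀ : aeval (plucker u₀ w₀) q ≠ 0) {P : PPoint k (PluckerIndex m) → Prop}
    (hP : ∀ (u w : Fin m → Ω) (h : plucker u w ≠ 0), aeval (plucker u w) q ≠ 0 →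
      P (Projectivization.mk Ω _ h)) :
    GenericallyOn (grassmannianOfLines k m) P := by
  let φ : PluckerIndex m → MvPolynomial (Fin m ⊕ Fin m) k := fun s =>
    X (Sum.inl s.1.1) * X (Sum.inr s.1.2) - X (Sum.inl s.1.2) * X (Sum.inr s.1.1)
  have hφ : ∀ t : Fin m ⊕ Fin m → Ω, (fun s => aeval t (φ s)) =
      plucker (fun j => t (Sum.inl j)) (fun j => t (Sum.inr j)) := fun t => by
    ext s
    simp [φ, plucker]
  have hφ' : ∀ u w : Fin m → Ω, (fun s => aeval (Sum.elim u w) (φ s)) = plucker u w := fun u w =>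
    hφ _
  refine genericallyOn_of_parametrization φ ?_ ?_ hq (t₀ := Sum.elim u₀ w₀) ?_ ?_ ?_
  · rintro x ⟨l, a, b, -, h, rfl⟩
    refine ⟨Sum.elim a b, by rw [hφ']; exact h, ?_⟩
    congr 1
    exact (hφ' a b).symm
  · intro t ht
    have ht' := ht
    rw [hφ] at ht'
    convert mk_plucker_mem ht' using 2
    exact hφ t
  · rwa [hφ']
  · rwa [hφ']
  · intro t ht hqt
    have ht' := ht
    rw [hφ] at ht' hqt
    convert hP _ _ ht' hqt using 2
    exact hφ t

end Grassmannian

/-! ### From a point to the line joining the projections of its components -/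

section ProjectedLine

variable {k : Type*} [Field k] {K : Type*} [Field K] [Algebra k K] {ι : Type*} [Fintype ι]
  {m : ℕ} {A : Matrix (Fin m) ι k} {J : Matrix ι ι k} {δ : K}

/-- The quadratic map from the ambient space of the hypersurface to that of the Grassmannian. -/
noncomputable def projectedLine (A : Matrix (Fin m) ι k) (J : Matrix ι ι k) (s : PluckerIndex m) :
    MvPolynomial ι k :=
  (A * J).toMvPolynomial s.1.1 * A.toMvPolynomial s.1.2 -
    (A * J).toMvPolynomial s.1.2 * A.toMvPolynomial s.1.1

theorem projectedLine_isHomogeneous (A : Matrix (Fin m) ι k) (J : Matrix ι ι k)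
    (s : PluckerIndex m) : (projectedLine A J s).IsHomogeneous 2 :=
  ((Matrix.toMvPolynomial_isHomogeneous _ _).mul (Matrix.toMvPolynomial_isHomogeneous _ _)).sub
    ((Matrix.toMvPolynomial_isHomogeneous _ _).mul (Matrix.toMvPolynomial_isHomogeneous _ _))

theorem aeval_projectedLine (A : Matrix (Fin m) ι k) (J : Matrix ι ι k) (v : ι → K) :
    (fun s => aeval v (projectedLine A J s)) =
      plucker (extendMatrix K A (extendMatrix K J v)) (extendMatrix K A v) := by
  ext s
  simp only [projectedLine, map_sub, map_mul, aeval_matrixToMvPolynomial, plucker, extendMatrix_mul]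

theorem IsTwist.projectedLine {v w : ι → K} (h : IsTwist J δ v w) :
    ∃ c : K, c ≠ 0 ∧ (fun s => aeval w (projectedLine A J s)) =
      c • fun s => aeval v (projectedLine A J s) := by
  obtain ⟨a, b, s, t, ha, hb, hs, ht, rfl, rfl⟩ := h
  refine ⟨s * t, mul_ne_zero hs ht, ?_⟩
  have h1 := extendMatrix_smul_add_smul ha hb 1 1
  rw [one_smul, one_smul] at h1
  rw [aeval_projectedLine, aeval_projectedLine, extendMatrix_smul_add_smul ha hb, h1]
  simp only [map_add, map_smul]
  ext l
  simp only [plucker, Pi.smul_apply, Pi.add_apply, smul_eq_mul]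
  ring

end ProjectedLine

/-! ### From a line back to a vector, linearly in Plücker coordinates -/

section Lift

variable {k : Type*} [Field k] {K : Type*} [Field K] [Algebra k K] {ι : Type*} [Fintype ι]
  [DecidableEq ι] {m : ℕ}

/-- For a projection `A` from a linear space that meets neither eigenspace of `J`: the coefficients
`α` and `β` of a relation between `A` and `A * J`, and those of a left inverse of the pair. -/
structure LiftData (A : Matrix (Fin m) ι k) (J : Matrix ι ι k) where
  α : Fin m → k
  β : Fin m → k
  N₁ : Matrix ι (Fin m) k
  N₂ : Matrix ι (Fin m) k
  relation : Matrix.vecMul α A + Matrix.vecMul β (A * J) = 0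
  vecMul_ne_zero : Matrix.vecMul β A ≠ 0
  left_inverse : N₁ * A + N₂ * (A * J) = 1

/-- The rows of `A` and `A * J` number `2m`, more than the dimension, whence a relation.
Surjectivity of `A` rules out `β = 0`, and `hinj` provides a left inverse of the stacked matrix. -/
theorem exists_liftData {A : Matrix (Fin m) ι k} {J : Matrix ι ι k}
    (hsurj : Function.Surjective A.mulVec) (hinj : ∀ v, A.mulVec v = 0 → (A * J).mulVec v = 0 → v = 0)
    (hcard : Fintype.card ι < 2 * m) : Nonempty (LiftData A J) := by
  have hA : ∀ γ : Fin m → k, Matrix.vecMul γ A = 0 → γ = 0 := fun γ hγ => by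
    ext j
    obtain ⟨v, hv⟩ := hsurj (Pi.single j 1)
    have := Matrix.dotProduct_mulVec γ A v
    rw [hγ, hv] at this
    simpa using this
  let R : ((Fin m → k) × (Fin m → k)) →ₗ[k] (ι → k) :=
    A.vecMulLinear.coprod (A * J).vecMulLinear
  have hR : LinearMap.ker R ≠ ⊥ := by
    refine LinearMap.ker_ne_bot_of_finrank_lt ?_
    rw [Module.finrank_prod, Module.finrank_fintype_fun_eq_card, Module.finrank_fintype_fun_eq_card,
      Fintype.card_fin]
    omega
  obtain ⟨⟨α, β⟩, hαβ, hne⟩ := (Submodule.ne_bot_iff _).1 hR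
  have hrel : Matrix.vecMul α A + Matrix.vecMul β (A * J) = 0 := hαβ
  have hβ : β ≠ 0 := by
    rintro rfl
    rw [Matrix.zero_vecMul, add_zero] at hrel
    exact hne (by rw [hA α hrel]; rfl)
  let E : Matrix (Fin m ⊕ Fin m) ι k := Matrix.fromRows A (A * J)
  have hE : LinearMap.ker E.mulVecLin = ⊥ := by
    refine (Submodule.eq_bot_iff _).2 fun v hv => ?_
    have hv' : E.mulVec v = 0 := hv
    rw [Matrix.fromRows_mulVec] at hv'
    refine hinj v ?_ ?_
    · ext j
      exact congrFun hv' (Sum.inl j)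
    · ext j
      exact congrFun hv' (Sum.inr j)
  obtain ⟨N, hN⟩ := LinearMap.exists_leftInverse_of_injective E.mulVecLin hE
  have hN' : LinearMap.toMatrix' N * E = 1 := by
    rw [← LinearMap.toMatrix'_id, ← hN, LinearMap.toMatrix'_comp,
      ← Matrix.toLin'_apply', LinearMap.toMatrix'_toLin']
  refine ⟨⟨α, β, (LinearMap.toMatrix' N).toCols₁, (LinearMap.toMatrix' N).toCols₂, hrel,
    fun h => hβ (hA β h), ?_⟩⟩
  rw [← Matrix.fromCols_mul_fromRows, Matrix.fromCols_toCols, hN']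

variable {A : Matrix (Fin m) ι k} {J : Matrix ι ι k} {D : k} {δ : K} {F : MvPolynomial ι k} {d : ℕ}

/-- The linear map on Plücker vectors that lifts the points of intersection of a line with the
images of the two eigenspaces of `J`, and adds up the lifts. -/
noncomputable def LiftData.lift (L : LiftData A J) (D : k) (i : ι) : MvPolynomial (PluckerIndex m) k :=
  ∑ j, C (L.N₁ i j) * contraction L.α j + ∑ j, C (D * L.N₂ i j) * contraction L.β j

theorem LiftData.lift_isHomogeneous (L : LiftData A J) (D : k) (i : ι) :
    (L.lift D i).IsHomogeneous 1 := by
  refine IsHomogeneous.add ?_ ?_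
  · exact IsHomogeneous.sum _ _ _ fun j _ => by
      simpa using (isHomogeneous_C _ (L.N₁ i j)).mul (contraction_isHomogeneous L.α j)
  · refine IsHomogeneous.sum _ _ _ fun j _ => ?_
    have := (isHomogeneous_C (PluckerIndex m) (D * L.N₂ i j)).mul (contraction_isHomogeneous L.β j)
    rwa [zero_add] at this

theorem LiftData.aeval_lift (L : LiftData A J) (D : k) (u w : Fin m → K) :
    (fun i => aeval (plucker u w) (L.lift D i)) =
      extendMatrix K L.N₁ (extendForm K L.α w • u - extendForm K L.α u • w) +
      extendMatrix K L.N₂ (algebraMap k K D • (extendForm K L.β w • u - extendForm K L.β u • w)) := by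
  rw [← aeval_contraction, ← aeval_contraction]
  ext i
  rw [Pi.add_apply, extendMatrix_apply, extendMatrix_apply]
  simp only [LiftData.lift, map_add, map_sum, map_mul, aeval_C, Pi.smul_apply, smul_eq_mul]
  congr 1
  exact Finset.sum_congr rfl fun j _ => by ring

theorem LiftData.extendMatrix_add (L : LiftData A J) (v : ι → K) :
    extendMatrix K L.N₁ (extendMatrix K A v) +
      extendMatrix K L.N₂ (extendMatrix K A (extendMatrix K J v)) = v := by
  rw [← extendMatrix_mul, ← extendMatrix_mul, ← extendMatrix_mul, Matrix.mul_assoc]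
  have h := congrArg (fun M : Matrix ι ι k => extendMatrix K M v) L.left_inverse
  have h1 : extendMatrix K (1 : Matrix ι ι k) v = v := by simp [extendMatrix]
  simp only [h1] at h
  refine Eq.trans ?_ h
  simp only [extendMatrix, Matrix.mulVecLin_apply, Matrix.map_add _ (map_add (algebraMap k K)),
    Matrix.add_mulVec]

/-- If the projections of `v` and `J v` are the contractions of a Plücker vector, then `v` is its
lift. -/
theorem LiftData.aeval_lift_eq (L : LiftData A J) {u w : Fin m → K} {v : ι → K}
    (h₁ : extendMatrix K A v = extendForm K L.α w • u - extendForm K L.α u • w)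
    (h₂ : extendMatrix K A (extendMatrix K J v) =
      algebraMap k K D • (extendForm K L.β w • u - extendForm K L.β u • w)) :
    (fun i => aeval (plucker u w) (L.lift D i)) = v := by
  rw [L.aeval_lift, ← h₁, ← h₂, L.extendMatrix_add]

theorem LiftData.extendForm_relation (L : LiftData A J) (v : ι → K) :
    extendForm K L.α (extendMatrix K A v) =
      -extendForm K L.β (extendMatrix K A (extendMatrix K J v)) := by
  rw [← extendMatrix_mul, ← extendForm_vecMul, ← extendForm_vecMul, eq_neg_iff_add_eq_zero]
  have h : ∀ i, Matrix.vecMul L.α A i + Matrix.vecMul L.β (A * J) i = 0 := fun i =>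
    congrFun L.relation i
  rw [extendForm_apply, extendForm_apply, ← Finset.sum_add_distrib]
  refine Finset.sum_eq_zero fun i _ => ?_
  rw [← add_mul, ← map_add, h, map_zero, zero_mul]

/-- Passing from `v` to its line and back twists `v`, first by the balanced map of `βA` and then by
`J`; this makes the two maps inverse once residual points are taken. -/
theorem LiftData.aeval_lift_projectedLine (L : LiftData A J) (hJ : J * J = D • 1) (v : ι → K) :
    (fun i => aeval (fun s => aeval v (projectedLine A J s)) (L.lift D i)) =
      extendMatrix K J (fun i => aeval v (balancedMap J (Matrix.vecMul L.β A) i)) := by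
  rw [aeval_projectedLine, aeval_balancedMap]
  refine L.aeval_lift_eq ?_ ?_
  · simp only [map_sub, map_smul, extendForm_vecMul, extendMatrix_extendMatrix hJ,
      L.extendForm_relation, smul_eq_mul]
    module
  · simp only [map_sub, map_smul, extendForm_vecMul, extendMatrix_extendMatrix hJ]
    module

/-- Identifies the genericity condition on lines with the norm form of `βA`, so one test vector
serves both. -/
theorem LiftData.aeval_wedgeForm_projectedLine (L : LiftData A J) (hJ : J * J = D • 1)
    (v : ι → K) :
    aeval (fun s => aeval v (projectedLine A J s)) (wedgeForm L.α L.β) =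
      -aeval v (normForm J D (2 * 0 + 1) (linearForm (Matrix.vecMul L.β A))) := by
  rw [aeval_projectedLine, aeval_wedgeForm, aeval_normForm, aeval_linearForm, aeval_linearForm,
    L.extendForm_relation, L.extendForm_relation, extendMatrix_extendMatrix hJ, extendForm_vecMul,
    extendForm_vecMul, map_smul, map_smul, smul_eq_mul]
  ring

end Lift

/-! ### The intersection of the hypersurface with the line through `a` and `b` -/

section ThirdPointLine

variable {k : Type*} [Field k] [CharZero k] {ι : Type*} [Fintype ι]

local notation "Ω" => AlgebraicClosure k

variable {J : Matrix ι ι k} {D : k} {δ : AlgebraicClosure k} {F : MvPolynomial ι k} {d : ℕ}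
  {a b : ι → AlgebraicClosure k}

/-- If `a = 0`, then `F(sa + tb)` does not depend on `s`. For `d ≥ 1` it vanishes at `s = 0`, and
comparison with `s = 1` and `s = -1` gives `P = Q = 0`, against the norm form. The case `b = 0` is
symmetric. -/
theorem eigenvectors_ne_zero (hδ : δ ^ 2 = algebraMap k Ω D) (hd : 1 ≤ d)
    (hF : F.IsHomogeneous (2 * d + 1)) (hsplit : IsSplitForm J δ d F)
    (ha : extendMatrix Ω J a = δ • a) (hb : extendMatrix Ω J b = (-δ) • b)
    (hv : (aeval (a + b) (normForm J D (2 * d + 1) F) : Ω) ≠ 0) : a ≠ 0 ∧ b ≠ 0 := by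
  obtain ⟨P, Q, hPQ⟩ := hsplit a b ha hb
  have h2 := aeval_normForm_smul_add_smul hδ ha hb hF hPQ 1 1
  rw [one_smul, one_smul] at h2
  rw [h2] at hv
  have hd0 : d ≠ 0 := by omega
  have hsq : ((-1 : Ω) ^ d) ≠ 0 := pow_ne_zero _ (by simp)
  constructor
  · rintro rfl
    have e0 := hPQ 0 1
    have e1 := hPQ 1 1
    have e2 := hPQ (-1) 1
    simp only [smul_zero, zero_add, one_smul, zero_pow hd0, zero_mul, one_pow, one_mul, mul_one]
      at e0 e1 e2
    rw [e0] at e1 e2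
    have e3 := (mul_eq_zero.1 e2.symm).resolve_left hsq
    have : 2 * P = 0 := by linear_combination -e1 - e3
    refine hv ?_
    have hP : P = 0 := (mul_eq_zero.1 this).resolve_left (by
      have : CharZero Ω := algebraRat.charZero _
      exact two_ne_zero)
    rw [hP]; ring
  · rintro rfl
    have e0 := hPQ 1 0
    have e1 := hPQ 1 1
    have e2 := hPQ 1 (-1)
    simp only [smul_zero, add_zero, one_smul, zero_pow hd0, zero_mul, mul_zero, one_pow, one_mul,
      mul_one] at e0 e1 e2
    rw [e0] at e1 e2
    have e3 := (mul_eq_zero.1 e2.symm).resolve_left hsq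
    have : 2 * P = 0 := by linear_combination -e1 + e3
    refine hv ?_
    have hP : P = 0 := (mul_eq_zero.1 this).resolve_left (by
      have : CharZero Ω := algebraRat.charZero _
      exact two_ne_zero)
    rw [hP]; ring

/-- The line through points `a` and `b` of the two eigenspaces of `J` meets the hypersurface in one
further point. -/
theorem setOf_mem_line_diff_eq_singleton [DecidableEq ι] (hD : ¬ IsSquare D) (hδ : δ ^ 2 = algebraMap k Ω D)
    (hF : F.IsHomogeneous (2 * d + 1)) (hsplit : IsSplitForm J δ d F)
    (ha : extendMatrix Ω J a = δ • a) (hb : extendMatrix Ω J b = (-δ) • b)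
    (ha0 : a ≠ 0) (hb0 : b ≠ 0)
    (hv : (aeval (a + b) (normForm J D (2 * d + 1) F) : Ω) ≠ 0)
    (hT : (fun i => aeval (a + b) (thirdPointMap F J D d i)) ≠ 0) :
    {y | y ∈ hypersurface F ∧ y.submodule ≤
        (Projectivization.mk Ω a ha0).submodule ⊔ (Projectivization.mk Ω b hb0).submodule} \
      {Projectivization.mk Ω a ha0, Projectivization.mk Ω b hb0} =
      {Projectivization.mk Ω _ hT} := by
  have : CharZero Ω := algebraRat.charZero _
  have hδ0 := ne_zero_of_not_isSquare hD hδ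
  obtain ⟨P, Q, hPQ⟩ := hsplit a b ha hb
  have h1 := aeval_thirdPointMap_smul_add_smul hδ ha hb hF hPQ 1 1
  have h2 := aeval_normForm_smul_add_smul hδ ha hb hF hPQ 1 1
  rw [one_smul, one_smul] at h1 h2
  rw [h2] at hv
  simp only [mul_one, one_pow, ne_eq, mul_eq_zero, not_or] at hv
  obtain ⟨-, hP, hQ⟩ := hv
  have hc : 2 * δ ^ (2 * d + 1) * (1 * 1) ^ (d + 1) ≠ 0 := by simp [hδ0]
  set c := 2 * δ ^ (2 * d + 1) * (1 * 1) ^ (d + 1) with hcdef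
  have hindep : ∀ s t : Ω, s • a + t • b = 0 → s = 0 ∧ t = 0 := by
    intro s t h0
    have h3 := extendMatrix_smul_add_smul ha hb s t
    rw [h0, map_zero, eq_comm, smul_eq_zero_iff_right hδ0] at h3
    constructor
    · have : (2 * s) • a = (s • a + t • b) + (s • a + (-t) • b) := by module
      rw [h0, h3, add_zero, smul_eq_zero_iff_left ha0] at this
      simpa using this
    · have : (2 * t) • b = (s • a + t • b) - (s • a + (-t) • b) := by module
      rw [h0, h3, sub_zero, smul_eq_zero_iff_left hb0] at this
      simpa using this
  have hline : ∀ (z : ι → Ω) (hz : z ≠ 0), (Projectivization.mk Ω z hz).submodule ≤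
      (Projectivization.mk Ω a ha0).submodule ⊔ (Projectivization.mk Ω b hb0).submodule ↔
        ∃ s t : Ω, s • a + t • b = z := by
    intro z hz
    rw [Projectivization.submodule_mk, Projectivization.submodule_mk, Projectivization.submodule_mk,
      Submodule.span_singleton_le_iff_mem, ← Submodule.span_union, Set.singleton_union,
      Submodule.mem_span_pair]
  ext y
  induction y using Projectivization.ind with
  | h z hz =>
  simp only [Set.mem_sdiff, Set.mem_ofPred_eq, Set.mem_insert_iff, Set.mem_singleton_iff, not_or,
    mem_hypersurface_mk hF, hline, Projectivization.mk_eq_mk_iff']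
  constructor
  · rintro ⟨⟨hFz, s, t, rfl⟩, hna, hnb⟩
    have hs : s ≠ 0 := by
      rintro rfl
      exact hnb ⟨t, by simp⟩
    have ht : t ≠ 0 := by
      rintro rfl
      exact hna ⟨s, by simp⟩
    rw [hPQ, mul_eq_zero] at hFz
    have hst := hFz.resolve_left (mul_ne_zero (pow_ne_zero _ hs) (pow_ne_zero _ ht))
    -- Read off from the coefficient of `a`, which is `cQ` in the residual vector; that of `b` then
    -- agrees because `sP + tQ = 0`.
    refine ⟨s / (Q * c), ?_⟩
    rw [h1, smul_smul, smul_sub, smul_smul, smul_smul, sub_eq_add_neg, ← neg_smul]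
    congr 2
    · field_simp
    · field_simp
      linear_combination -hst
  · rintro ⟨e, he⟩
    have he0 : e ≠ 0 := by
      rintro rfl
      rw [zero_smul] at he
      exact hz he.symm
    have hz' : (e * c * Q) • a + (-(e * c * P)) • b = z := by
      rw [← he, h1]; module
    refine ⟨⟨?_, _, _, hz'⟩, ?_, ?_⟩
    · rw [← hz', hPQ]; ring
    · rintro ⟨x, hx⟩
      have := (hindep (x - e * c * Q) (e * c * P) (by
        rw [sub_smul, hx, ← hz']; module)).2
      exact mul_ne_zero (mul_ne_zero he0 hc) hP this
    · rintro ⟨x, hx⟩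
      have := (hindep (e * c * Q) (-(e * c * P) - x) (by
        rw [sub_smul, hx, ← hz']; module)).1
      exact mul_ne_zero (mul_ne_zero he0 hc) hQ this

end ThirdPointLine

/-! ### Intersecting a general line with the images of the eigenspaces -/

section GeneralLine

variable {k : Type*} [Field k] {K : Type*} [Field K] [Algebra k K] {ι : Type*} [Fintype ι]
  [DecidableEq ι] {m : ℕ} {A : Matrix (Fin m) ι k} {J : Matrix ι ι k} {D : k} {δ : K}

/-- A vanishing coefficient `α_j + εβ_j` with `β_j ≠ 0` would make `D` the square of `α_j / β_j`. -/
theorem LiftData.form_ne_zero (L : LiftData A J) (hD : ¬ IsSquare D)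
    (hδ : δ ^ 2 = algebraMap k K D) {ε : K} (hε : ε = δ ∨ ε = -δ) :
    extendForm K L.α + ε • extendForm K L.β ≠ 0 := by
  intro h0
  have hβ : L.β ≠ 0 := fun h => L.vecMul_ne_zero (by rw [h, Matrix.zero_vecMul])
  obtain ⟨j, hj⟩ := Function.ne_iff.1 hβ
  have h1 := LinearMap.congr_fun h0 (Pi.single j 1)
  simp only [LinearMap.add_apply, LinearMap.smul_apply, extendForm_apply, Pi.single_apply, mul_ite,
    mul_one, mul_zero, Finset.sum_ite_eq', Finset.mem_univ, if_true, smul_eq_mul,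
    LinearMap.zero_apply] at h1
  have hε2 : ε ^ 2 = algebraMap k K D := by
    rcases hε with rfl | rfl
    · exact hδ
    · rw [neg_sq, hδ]
  refine hD ⟨L.α j / L.β j, ?_⟩
  have hj' : L.β j ≠ 0 := hj
  field_simp
  refine (algebraMap k K).injective ?_
  rw [map_mul, map_pow, map_pow, ← hε2]
  linear_combination (-(algebraMap k K (L.α j)) + ε * algebraMap k K (L.β j)) * h1

theorem LiftData.form_extendMatrix (L : LiftData A J) {ε : K} {a : ι → K}
    (ha : extendMatrix K J a = ε • a) :
    (extendForm K L.α + ε • extendForm K L.β) (extendMatrix K A a) = 0 := by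
  rw [LinearMap.add_apply, LinearMap.smul_apply, L.extendForm_relation, ha, map_smul, map_smul]
  simp

/-- The projection maps an eigenspace of `J` onto a hyperplane. -/
theorem LiftData.exists_eigenvector (L : LiftData A J) {n : ℕ} (hm : m = n + 2) {ε : K}
    (hform : extendForm K L.α + ε • extendForm K L.β ≠ 0) (W : Submodule K (ι → K))
    (hW : ∀ v, v ∈ W ↔ extendMatrix K J v = ε • v) (hdim : Module.finrank K W = n + 1)
    (hinj : ∀ v ∈ W, extendMatrix K A v = 0 → v = 0) {u : Fin m → K}
    (hu : (extendForm K L.α + ε • extendForm K L.β) u = 0) :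
    ∃ a ∈ W, extendMatrix K A a = u := by
  have hle : W.map (extendMatrix K A) ≤
      LinearMap.ker (extendForm K L.α + ε • extendForm K L.β) := by
    rintro _ ⟨a, ha, rfl⟩
    exact L.form_extendMatrix ((hW a).1 ha)
  have hinj' : Function.Injective ((extendMatrix K A).domRestrict W) := by
    rw [← LinearMap.ker_eq_bot, Submodule.eq_bot_iff]
    rintro ⟨v, hv⟩ h0
    exact Subtype.ext (hinj v hv h0)
  have h1 : Module.finrank K (W.map (extendMatrix K A)) = n + 1 := by
    rw [← hdim, ← LinearMap.finrank_range_of_inj hinj', LinearMap.range_domRestrict]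
  have h2 := Module.Dual.finrank_ker_add_one_of_ne_zero (K := K) hform
  rw [Module.finrank_fintype_fun_eq_card, Fintype.card_fin] at h2
  -- The image of `W` has dimension `n + 1`, as has a hyperplane in dimension `m = n + 2`.
  have h3 := Submodule.eq_of_le_of_finrank_eq hle (by omega)
  have : u ∈ W.map (extendMatrix K A) := by
    rw [h3]; exact hu
  exact this

/-- The lift of a line is the sum of the lifts of its points of intersection with the images of the
two eigenspaces of `J`. -/
theorem LiftData.exists_lift_eq_add [CharZero K] (L : LiftData A J) {n : ℕ} (hm : m = n + 2)
    (hD : ¬ IsSquare D) (hδ : δ ^ 2 = algebraMap k K D) (Wp Wm : Submodule K (ι → K))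
    (hWp : ∀ v, v ∈ Wp ↔ extendMatrix K J v = δ • v)
    (hWm : ∀ v, v ∈ Wm ↔ extendMatrix K J v = (-δ) • v)
    (hdimp : Module.finrank K Wp = n + 1) (hdimm : Module.finrank K Wm = n + 1)
    (hinjp : ∀ v ∈ Wp, extendMatrix K A v = 0 → v = 0)
    (hinjm : ∀ v ∈ Wm, extendMatrix K A v = 0 → v = 0) (u w : Fin m → K) :
    ∃ a ∈ Wp, ∃ b ∈ Wm, (fun i => aeval (plucker u w) (L.lift D i)) = a + b ∧
      extendMatrix K A (a + b) = extendForm K L.α w • u - extendForm K L.α u • w ∧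
      extendMatrix K A (extendMatrix K J (a + b)) =
        algebraMap k K D • (extendForm K L.β w • u - extendForm K L.β u • w) ∧
      (2 : K) • extendMatrix K A a = (extendForm K L.α + δ • extendForm K L.β) w • u -
        (extendForm K L.α + δ • extendForm K L.β) u • w ∧
      (2 : K) • extendMatrix K A b = (extendForm K L.α + (-δ) • extendForm K L.β) w • u -
        (extendForm K L.α + (-δ) • extendForm K L.β) u • w := by
  -- With the factor 1/2, the two contractions, by `α + δβ` and `α - δβ`, add up to the contraction
  -- by `α`, and `δ` times their difference is `D` times that by `β`. Both have coefficients in `k`.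
  have hmem : ∀ φ : (Fin m → K) →ₗ[K] K, φ ((2 : K)⁻¹ • (φ w • u - φ u • w)) = 0 := fun φ => by
    simp [mul_comm]
  obtain ⟨a, ha, hAa⟩ := L.exists_eigenvector hm (L.form_ne_zero hD hδ (Or.inl rfl)) Wp hWp hdimp
    hinjp (hmem _)
  obtain ⟨b, hb, hAb⟩ := L.exists_eigenvector hm (L.form_ne_zero hD hδ (Or.inr rfl)) Wm hWm hdimm
    hinjm (hmem _)
  have h₁ : extendMatrix K A (a + b) = extendForm K L.α w • u - extendForm K L.α u • w := by
    rw [map_add, hAa, hAb]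
    simp only [LinearMap.add_apply, LinearMap.smul_apply, smul_eq_mul]
    match_scalars <;> field_simp <;> ring
  have h₂ : extendMatrix K A (extendMatrix K J (a + b)) =
      algebraMap k K D • (extendForm K L.β w • u - extendForm K L.β u • w) := by
    rw [map_add, (hWp a).1 ha, (hWm b).1 hb, map_add, map_smul, map_smul, hAa, hAb, ← hδ]
    simp only [LinearMap.add_apply, LinearMap.smul_apply, smul_eq_mul]
    match_scalars <;> field_simp <;> ring
  refine ⟨a, ha, b, hb, L.aeval_lift_eq h₁ h₂, h₁, h₂, ?_, ?_⟩
  · rw [hAa, smul_smul, mul_inv_cancel₀ two_ne_zero, one_smul]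
  · rw [hAb, smul_smul, mul_inv_cancel₀ two_ne_zero, one_smul]

end GeneralLine

/-- The inverse image of a line under the projection meets an eigenspace of `J` in one point. -/
theorem comap_inf_eq_span_singleton {k K ι : Type*} [Field k] [Field K]
    [Algebra k K] [CharZero K] [Fintype ι] {m : ℕ} {A : Matrix (Fin m) ι k} {φ : (Fin m → K) →ₗ[K] K} (W : Submodule K (ι → K))
    (hφ : ∀ v ∈ W, φ (extendMatrix K A v) = 0)
    (hinj : ∀ v ∈ W, extendMatrix K A v = 0 → v = 0) {u w : Fin m → K} {a : ι → K} (ha : a ∈ W)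
    (ha0 : a ≠ 0) (hAa : (2 : K) • extendMatrix K A a = φ w • u - φ u • w) :
    (Submodule.span K {u, w}).comap (extendMatrix K A) ⊓ W = Submodule.span K {a} := by
  have hAa0 : extendMatrix K A a ≠ 0 := fun h => ha0 (hinj a ha h)
  have huniq : ∀ (v : ι → K) (c : K), v ∈ W → extendMatrix K A v = c • extendMatrix K A a →
      v ∈ Submodule.span K {a} := by
    intro v c hv hc
    refine Submodule.mem_span_singleton.2 ⟨c, ?_⟩
    have := hinj (c • a - v) (W.sub_mem (W.smul_mem c ha) hv) (by rw [map_sub, map_smul, hc, sub_self])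
    exact sub_eq_zero.1 this
  refine le_antisymm ?_ ?_
  · rintro v ⟨hv, hvW⟩
    obtain ⟨x, y, hxy⟩ := Submodule.mem_span_pair.1 (Submodule.mem_comap.1 hv)
    have h0 := hφ v hvW
    rw [← hxy, map_add, map_smul, map_smul, smul_eq_mul, smul_eq_mul] at h0
    -- As `Aa ≠ 0`, the form `φ` is not identically zero on the line, so its kernel there is
    -- one-dimensional; the scalar is read off from whichever of `φ w`, `φ u` is nonzero.
    by_cases hw : φ w = 0
    · have hu : φ u ≠ 0 := by
        intro hu
        rw [hw, hu, zero_smul, zero_smul, sub_zero, smul_eq_zero] at hAa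
        exact hAa0 (hAa.resolve_left two_ne_zero)
      have hx : x = 0 := by
        rw [hw, mul_zero, add_zero, mul_eq_zero] at h0
        exact h0.resolve_right hu
      refine huniq v (-(2 * y / φ u)) hvW ?_
      rw [show (-(2 * y / φ u)) • extendMatrix K A a =
        (-(y / φ u)) • (2 : K) • extendMatrix K A a by module, hAa, hw, ← hxy, hx]
      match_scalars <;> field_simp
      ring
    · refine huniq v (2 * x / φ w) hvW ?_
      rw [show (2 * x / φ w) • extendMatrix K A a =
        (x / φ w) • (2 : K) • extendMatrix K A a by module, hAa, ← hxy]
      match_scalars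
      · field_simp
      · field_simp
        linear_combination h0
  · rw [Submodule.span_singleton_le_iff_mem]
    refine ⟨Submodule.mem_comap.2 ?_, ha⟩
    rw [Submodule.mem_span_pair]
    refine ⟨φ w / 2, -(φ u / 2), ?_⟩
    have : extendMatrix K A a = (2 : K)⁻¹ • (2 : K) • extendMatrix K A a := by
      rw [smul_smul, inv_mul_cancel₀ two_ne_zero, one_smul]
    rw [this, hAa]
    module

/-! ### The map from lines to third points -/

section LineMap

variable {k : Type*} [Field k] {K : Type*} [Field K] [Algebra k K] {ι : Type*} [Fintype ι]
  [DecidableEq ι] {m : ℕ} {A : Matrix (Fin m) ι k} {J : Matrix ι ι k} {D : k}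
  {F : MvPolynomial ι k} {d : ℕ}

/-- The birational map, in Plücker coordinates, that sends a line to the third point. -/
noncomputable def LiftData.lineMap (L : LiftData A J) (F : MvPolynomial ι k) (D : k) (d : ℕ) (i : ι) :
    MvPolynomial (PluckerIndex m) k :=
  aeval (L.lift D) (thirdPointMap F J D d i)

/-- The form whose nonvanishing makes a line general. -/
noncomputable def LiftData.lineForm (L : LiftData A J) (F : MvPolynomial ι k) (D : k) (d : ℕ) :
    MvPolynomial (PluckerIndex m) k :=
  aeval (L.lift D) (normForm J D (2 * d + 1) F) * wedgeForm L.α L.β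

theorem LiftData.lineMap_isHomogeneous (L : LiftData A J) (hF : F.IsHomogeneous (2 * d + 1)) (i : ι) :
    (L.lineMap F D d i).IsHomogeneous (2 * d + 2) := by
  have := (thirdPointMap_isHomogeneous hF J D i).aeval (L.lift D) (L.lift_isHomogeneous D)
  rwa [one_mul] at this

theorem LiftData.aeval_lineMap (L : LiftData A J) (ω : PluckerIndex m → K) :
    (fun i => aeval ω (L.lineMap F D d i)) =
      fun i => aeval (fun i => aeval ω (L.lift D i)) (thirdPointMap F J D d i) :=
  _root_.funext fun _ => comp_aeval_apply _ _ _

theorem LiftData.aeval_lineForm (L : LiftData A J) (ω : PluckerIndex m → K) :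
    aeval ω (L.lineForm F D d) =
      aeval (fun i => aeval ω (L.lift D i)) (normForm J D (2 * d + 1) F) *
        aeval ω (wedgeForm L.α L.β) := by
  rw [LiftData.lineForm, map_mul, comp_aeval_apply]

end LineMap

/-! ### Birationality of the Grassmannian and the hypersurface -/

section LinesBirational

variable {k : Type*} [Field k] [CharZero k] {ι : Type*} [Fintype ι] [DecidableEq ι] {m : ℕ}

local notation "Ω" => AlgebraicClosure k

variable {A : Matrix (Fin m) ι k} {J : Matrix ι ι k} {D : k} {δ : AlgebraicClosure k}
  {F : MvPolynomial ι k} {d : ℕ}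

theorem LiftData.genericallyOn_grassmannianOfLines (L : LiftData A J) (hD : ¬ IsSquare D)
    (hδ : δ ^ 2 = algebraMap k Ω D) (hJ : J * J = D • 1) (hF : F.IsHomogeneous (2 * d + 1))
    (hF0 : F ≠ 0) (hsplit : IsSplitForm J δ d F) {P : PPoint k (PluckerIndex m) → Prop}
    (hP : ∀ (u w : Fin m → Ω) (h : plucker u w ≠ 0),
      aeval (fun i => aeval (plucker u w) (L.lift D i)) (normForm J D (2 * d + 1) F) ≠ 0 →
      aeval (plucker u w) (wedgeForm L.α L.β) ≠ 0 → P (Projectivization.mk Ω _ h)) :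
    GenericallyOn (grassmannianOfLines k m) P := by
  have : CharZero Ω := algebraRat.charZero _
  have hq : (L.lineForm F D d).IsHomogeneous (1 * ((2 * d + 1) * 2) + 1) :=
    ((normForm_isHomogeneous hF J D (2 * d + 1)).aeval (L.lift D) (L.lift_isHomogeneous D)).mul
      (wedgeForm_isHomogeneous L.α L.β)
  obtain ⟨v, hv1, hv2⟩ := exists_aeval_normForm_ne_zero (K := Ω) (J := J) (d := d) hD hF0
    L.vecMul_ne_zero
  have htw := isTwist_balancedMap hD hδ hJ _ hv2
  have htw' := isTwist_extendMatrix hD hδ hJ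
    (fun i => aeval v (balancedMap J (Matrix.vecMul L.β A) i))
  -- The test line is the one attached to `v`: its lift is a twist of `v`, and its wedge form is
  -- minus a norm form of `v`.
  have hne : aeval (plucker (extendMatrix Ω A (extendMatrix Ω J v)) (extendMatrix Ω A v))
      (L.lineForm F D d) ≠ 0 := by
    rw [L.aeval_lineForm, ← aeval_projectedLine, L.aeval_lift_projectedLine hJ,
      L.aeval_wedgeForm_projectedLine hJ]
    exact mul_ne_zero (htw'.aeval_normForm_ne_zero hδ hF hsplit
      (htw.aeval_normForm_ne_zero hδ hF hsplit hv1)) (neg_ne_zero.2 hv2)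
  refine _root_.genericallyOn_grassmannianOfLines hq (fun h0 => hne ?_) hne fun u w h hquw => ?_
  · have := aeval_smul_of_isHomogeneous hq (0 : Ω) 0
    rw [h0]
    rwa [zero_smul, zero_pow (by omega), zero_mul] at this
  · rw [L.aeval_lineForm] at hquw
    exact hP u w h (left_ne_zero_of_mul hquw) (right_ne_zero_of_mul hquw)

theorem LiftData.areInverseBirational (L : LiftData A J) {n : ℕ} (hm : m = n + 2)
    (hD : ¬ IsSquare D) (hδ : δ ^ 2 = algebraMap k Ω D) (hJ : J * J = D • 1)
    (hF : F.IsHomogeneous (2 * d + 1)) (hFirr : Irreducible F) (hsplit : IsSplitForm J δ d F)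
    (Wp Wm : Submodule Ω (ι → Ω))
    (hWp : ∀ v, v ∈ Wp ↔ extendMatrix Ω J v = δ • v)
    (hWm : ∀ v, v ∈ Wm ↔ extendMatrix Ω J v = (-δ) • v)
    (hdimp : Module.finrank Ω Wp = n + 1) (hdimm : Module.finrank Ω Wm = n + 1)
    (hinjp : ∀ v ∈ Wp, extendMatrix Ω A v = 0 → v = 0)
    (hinjm : ∀ v ∈ Wm, extendMatrix Ω A v = 0 → v = 0) :
    AreInverseBirational (grassmannianOfLines k m) (hypersurface F) (L.lineMap F D d)
      (projectedLine A J) := by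
  have : CharZero Ω := algebraRat.charZero _
  have hδ0 := ne_zero_of_not_isSquare hD hδ
  have hD0 : algebraMap k Ω D ≠ 0 := hδ ▸ pow_ne_zero 2 hδ0
  have hf := L.lineMap_isHomogeneous (D := D) hF
  have hg := projectedLine_isHomogeneous A J
  refine ⟨⟨_, hf⟩, ⟨_, hg⟩, ?_, ?_⟩
  · refine L.genericallyOn_grassmannianOfLines hD hδ hJ hF hFirr.ne_zero hsplit
      fun u w h h1 h2 => ?_
    obtain ⟨a, -, b, -, hlift, hA, hAJ, -, -⟩ :=
      L.exists_lift_eq_add hm hD hδ Wp Wm hWp hWm hdimp hdimm hinjp hinjm u w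
    rw [hlift] at h1
    have htw := isTwist_thirdPointMap hD hδ hJ hF hsplit h1
    have hne := htw.ne_zero hδ0 (ne_zero_of_aeval_normForm_ne_zero hF h1)
    refine ⟨Projectivization.mk Ω _ hne, (mem_hypersurface_mk hF hne).2
      (aeval_thirdPointMap_eq_zero hD hδ hJ hF hsplit _), ?_, ?_⟩
    · exact sendsTo_mk hf h hne one_ne_zero (by rw [L.aeval_lineMap, hlift, one_smul])
    -- The residual point is a twist of the lift, so it determines the same line. That line is
    -- spanned by the contractions of `(u, w)` with `α` and `β`, hence is the original one when the
    -- wedge form is nonzero.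
    · obtain ⟨c, hc, hcg⟩ := htw.projectedLine (A := A)
      refine sendsTo_mk hg hne h (mul_ne_zero hc (mul_ne_zero (neg_ne_zero.2 hD0) h2)) ?_
      rw [hcg, aeval_projectedLine, hA, hAJ, mul_smul, aeval_wedgeForm]
      congr 1
      rw [show algebraMap k Ω D • (extendForm Ω L.β w • u - extendForm Ω L.β u • w) =
        (algebraMap k Ω D * extendForm Ω L.β w) • u + (-(algebraMap k Ω D * extendForm Ω L.β u)) • w
          by module, sub_eq_add_neg, ← neg_smul, plucker_combination]
      congr 1
      ring
  · refine genericallyOn_hypersurface_of_normForm hD hδ hJ hF hFirr hsplit L.vecMul_ne_zero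
      fun x hx hFx h1 h2 => ?_
    have htw := isTwist_balancedMap hD hδ hJ _ h2
    have htw' := isTwist_extendMatrix hD hδ hJ
      (fun i => aeval x (balancedMap J (Matrix.vecMul L.β A) i))
    have hne := htw'.ne_zero hδ0 (htw.ne_zero hδ0 hx)
    have hlift := L.aeval_lift_projectedLine hJ x
    have hy : (fun s => aeval x (projectedLine A J s)) ≠ 0 := by
      intro h0
      rw [h0] at hlift
      refine hne ?_
      rw [← hlift]
      ext i
      have := aeval_smul_of_isHomogeneous (L.lift_isHomogeneous D i) (0 : Ω) 0
      rwa [zero_smul, zero_pow one_ne_zero, zero_mul] at this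
    obtain ⟨c₁, hc₁, hT₁⟩ := htw.thirdPointMap hδ hF hsplit
    obtain ⟨c₂, hc₂, hT₂⟩ := htw'.thirdPointMap hδ hF hsplit
    obtain ⟨c₃, hc₃, hT₃⟩ := exists_thirdPointMap_eq_smul (J := J) (D := D) (d := d) hFx h1
    refine ⟨Projectivization.mk Ω _ hy, ?_,
      sendsTo_mk hg hx hy one_ne_zero (one_smul _ _).symm,
      sendsTo_mk hf hy hx (mul_ne_zero hc₂ (mul_ne_zero hc₁ hc₃)) ?_⟩
    · have hy' := hy
      rw [aeval_projectedLine] at hy'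
      convert mk_plucker_mem hy' using 2
      exact aeval_projectedLine A J x
    · rw [L.aeval_lineMap, hlift, hT₂, hT₁, hT₃, smul_smul, smul_smul, mul_assoc]

theorem LiftData.genericallyOn_isThirdPoint (L : LiftData A J) {n : ℕ} (hm : m = n + 2)
    (hD : ¬ IsSquare D) (hδ : δ ^ 2 = algebraMap k Ω D) (hJ : J * J = D • 1) (hd : 1 ≤ d)
    (hF : F.IsHomogeneous (2 * d + 1)) (hFirr : Irreducible F) (hsplit : IsSplitForm J δ d F)
    (Wp Wm : Submodule Ω (ι → Ω))
    (hWp : ∀ v, v ∈ Wp ↔ extendMatrix Ω J v = δ • v)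
    (hWm : ∀ v, v ∈ Wm ↔ extendMatrix Ω J v = (-δ) • v)
    (hdimp : Module.finrank Ω Wp = n + 1) (hdimm : Module.finrank Ω Wm = n + 1)
    (hinjp : ∀ v ∈ Wp, extendMatrix Ω A v = 0 → v = 0)
    (hinjm : ∀ v ∈ Wm, extendMatrix Ω A v = 0 → v = 0)
    (hsurj : Function.Surjective (extendMatrix Ω A)) :
    GenericallyOn (grassmannianOfLines k m) (fun P =>
      ∃ (H : Submodule Ω (ι → Ω)) (p q x : PPoint k ι),
        LinearMap.ker (extendMatrix Ω A) ≤ H ∧ IsPluckerPoint (H.map (extendMatrix Ω A)) P ∧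
        IsThirdPoint (hypersurface F) Wp Wm H p q x ∧ SendsTo (L.lineMap F D d) P x) := by
  have : CharZero Ω := algebraRat.charZero _
  have hδ0 := ne_zero_of_not_isSquare hD hδ
  have hf := L.lineMap_isHomogeneous (D := D) hF
  refine L.genericallyOn_grassmannianOfLines hD hδ hJ hF hFirr.ne_zero hsplit
    fun u w h h1 h2 => ?_
  obtain ⟨a, ha, b, hb, hlift, -, -, hAa, hAb⟩ :=
    L.exists_lift_eq_add hm hD hδ Wp Wm hWp hWm hdimp hdimm hinjp hinjm u w
  rw [hlift] at h1
  have htw := isTwist_thirdPointMap hD hδ hJ hF hsplit h1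
  have hne := htw.ne_zero hδ0 (ne_zero_of_aeval_normForm_ne_zero hF h1)
  obtain ⟨ha0, hb0⟩ := eigenvectors_ne_zero hδ hd hF hsplit ((hWp a).1 ha) ((hWm b).1 hb) h1
  refine ⟨(Submodule.span Ω {u, w}).comap (extendMatrix Ω A), Projectivization.mk Ω a ha0,
    Projectivization.mk Ω b hb0, Projectivization.mk Ω _ hne, ?_, ?_, ⟨?_, ?_, ?_⟩, ?_⟩
  · exact Submodule.comap_mono (f := extendMatrix Ω A) bot_le
  · rw [Submodule.map_comap_eq_of_surjective hsurj]
    exact ⟨u, w, rfl, h, rfl⟩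
  · rw [Projectivization.submodule_mk]
    exact comap_inf_eq_span_singleton Wp (fun v hv => L.form_extendMatrix ((hWp v).1 hv)) hinjp
      ha ha0 hAa
  · rw [Projectivization.submodule_mk]
    exact comap_inf_eq_span_singleton Wm (fun v hv => L.form_extendMatrix ((hWm v).1 hv)) hinjm
      hb hb0 hAb
  · exact setOf_mem_line_diff_eq_singleton hD hδ hF hsplit ((hWp a).1 ha) ((hWm b).1 hb) ha0 hb0
      h1 hne
  · exact sendsTo_mk hf h hne one_ne_zero (by rw [L.aeval_lineMap, hlift, one_smul])

end LinesBirational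

/-! ### Subspaces and points defined over `k` -/

section Rational

variable {k : Type*} [Field k] {ι : Type*}

local notation "Ω" => AlgebraicClosure k

/-- Expanding the entries of `v` in a `k`-basis of the closure, each coordinate vector is killed by
`A`, since `A` has entries in `k`. -/
theorem mem_extendScalarsToClosure_ker [Fintype ι] {κ : Type*} {A : Matrix κ ι k} {v : ι → Ω}
    (hv : extendMatrix Ω A v = 0) : v ∈ extendScalarsToClosure (LinearMap.ker A.mulVecLin) := by
  classical
  let B := Module.Basis.ofVectorSpace k Ω
  let s := Finset.univ.biUnion fun i => (B.repr (v i)).support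
  have hker : ∀ j, (fun i => B.repr (v i) j) ∈ LinearMap.ker A.mulVecLin := fun j => by
    rw [LinearMap.mem_ker]
    ext l
    have h := congrFun hv l
    rw [extendMatrix_apply] at h
    have h' := congrArg (fun x => B.repr x j) h
    simp only [← Algebra.smul_def, map_sum, map_smul, Finsupp.coe_finsetSum, Finset.sum_apply,
      Finsupp.smul_apply, smul_eq_mul, Pi.zero_apply, map_zero, Finsupp.coe_zero] at h'
    simpa [Matrix.mulVec, dotProduct] using h'
  have hv' : v = ∑ j ∈ s, B j • fun i => algebraMap k Ω (B.repr (v i) j) := by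
    ext i
    have hsub : (B.repr (v i)).support ⊆ s :=
      Finset.subset_biUnion_of_mem (fun i => (B.repr (v i)).support) (Finset.mem_univ i)
    conv_lhs => rw [← B.linearCombination_repr (v i), Finsupp.linearCombination_apply,
      Finsupp.sum_of_support_subset _ hsub _ (by simp)]
    simp [Algebra.smul_def, mul_comm]
  rw [hv']
  exact Submodule.sum_mem _ fun j _ => Submodule.smul_mem _ _ (Submodule.subset_span ⟨_, hker j, rfl⟩)

theorem extendScalarsToClosure_ker_le [Fintype ι] {κ : Type*} (A : Matrix κ ι k) :
    extendScalarsToClosure (LinearMap.ker A.mulVecLin) ≤ LinearMap.ker (extendMatrix Ω A) := by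
  refine Submodule.span_le.2 ?_
  rintro _ ⟨v, hv, rfl⟩
  have hv' : A.mulVec v = 0 := hv
  rw [SetLike.mem_coe, LinearMap.mem_ker, extendMatrix_algebraMap, hv']
  ext i
  simp

theorem extendScalarsToClosure_sup_span_singleton_le (Λ : Submodule k (ι → k)) (e : ι → k) :
    extendScalarsToClosure (Λ ⊔ Submodule.span k {e}) ≤
      extendScalarsToClosure Λ ⊔ Submodule.span Ω {fun i => algebraMap k Ω (e i)} := by
  refine Submodule.span_le.2 ?_
  rintro _ ⟨v, hv, rfl⟩
  obtain ⟨x, hx, y, hy, rfl⟩ := Submodule.mem_sup.1 hv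
  obtain ⟨c, rfl⟩ := Submodule.mem_span_singleton.1 hy
  refine Submodule.mem_sup.2 ⟨_, Submodule.subset_span ⟨x, hx, rfl⟩, _,
    Submodule.mem_span_singleton.2 ⟨algebraMap k Ω c, rfl⟩, ?_⟩
  ext i
  simp [Algebra.smul_def]

/-- A subspace over the algebraic closure has skew subspaces defined over `k` of every dimension up
to its codimension. -/
theorem exists_disjoint_extendScalarsToClosure [Fintype ι] (W : Submodule Ω (ι → Ω)) (j : ℕ)
    (hj : Module.finrank Ω W + j ≤ Fintype.card ι) :
    ∃ Λ : Submodule k (ι → k), Module.finrank k Λ = j ∧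
      Module.finrank Ω (extendScalarsToClosure Λ) ≤ j ∧ Disjoint (extendScalarsToClosure Λ) W := by
  classical
  induction j with
  | zero =>
    have h0 : extendScalarsToClosure (⊥ : Submodule k (ι → k)) = ⊥ := by
      refine (Submodule.span_eq_bot).2 ?_
      rintro _ ⟨v, hv, rfl⟩
      rw [(Submodule.mem_bot k).1 hv]
      ext i
      simp
    exact ⟨⊥, by simp, by simp [h0], by simp [h0]⟩
  | succ j ih =>
    obtain ⟨Λ, hΛ, hΛ', hdis⟩ := ih (by omega)
    -- The sum is a proper subspace by dimension, so it misses a standard basis vector, which has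
    -- entries in `k` and can be adjoined to `Λ`.
    obtain ⟨i, hi⟩ : ∃ i, (Pi.single i 1 : ι → Ω) ∉ extendScalarsToClosure Λ ⊔ W := by
      by_contra! hcon
      have htop : extendScalarsToClosure Λ ⊔ W = ⊤ := by
        refine eq_top_iff.2 fun v _ => ?_
        rw [pi_eq_sum_univ' v]
        exact Submodule.sum_mem _ fun i _ => Submodule.smul_mem _ _ (hcon i)
      have h1 := Submodule.finrank_add_le_finrank_add_finrank (extendScalarsToClosure Λ) W
      rw [htop, finrank_top, Module.finrank_fintype_fun_eq_card] at h1
      omega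
    have he : (fun l => algebraMap k Ω ((Pi.single i 1 : ι → k) l)) = Pi.single i 1 := by
      ext l
      rcases eq_or_ne l i with rfl | hl
      · simp
      · simp [hl]
    have hle := extendScalarsToClosure_sup_span_singleton_le Λ (Pi.single i 1)
    rw [he] at hle
    have hnot : (Pi.single i 1 : ι → k) ∉ Λ := fun h =>
      hi (Submodule.mem_sup_left (he ▸ Submodule.subset_span ⟨_, h, rfl⟩))
    have hne : (Pi.single i 1 : ι → k) ≠ 0 := by simp
    refine ⟨Λ ⊔ Submodule.span k {Pi.single i 1}, ?_, ?_, ?_⟩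
    · have h1 := Submodule.finrank_sup_add_finrank_inf_eq Λ (Submodule.span k {Pi.single i (1 : k)})
      have h2 : Disjoint Λ (Submodule.span k {Pi.single i (1 : k)}) :=
        (Submodule.disjoint_span_singleton' hne).2 hnot
      rw [h2.eq_bot, finrank_bot, finrank_span_singleton hne, hΛ] at h1
      exact h1
    · refine (Submodule.finrank_mono hle).trans
        ((Submodule.finrank_add_le_finrank_add_finrank _ _).trans ?_)
      rw [finrank_span_singleton (by simp : (Pi.single i 1 : ι → Ω) ≠ 0)]
      omega
    · rw [Submodule.disjoint_def]
      intro v hv hvW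
      obtain ⟨x, hx, y, hy, rfl⟩ := Submodule.mem_sup.1 (hle hv)
      obtain ⟨c, rfl⟩ := Submodule.mem_span_singleton.1 hy
      by_cases hc : c = 0
      · rw [hc, zero_smul, add_zero] at hvW ⊢
        exact Submodule.disjoint_def.1 hdis x hx hvW
      · refine absurd ?_ hi
        have : (Pi.single i 1 : ι → Ω) =
            c⁻¹ • (-x + (x + c • (Pi.single i 1 : ι → Ω))) := by
          rw [neg_add_cancel_left, smul_smul, inv_mul_cancel₀ hc, one_smul]
        rw [this]
        exact Submodule.smul_mem _ _
          (Submodule.add_mem_sup (Submodule.neg_mem _ hx) hvW)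

/-- An automorphism carrying `W` to `W'` preserves the extension of `Λ`, so disjointness is
transported. -/
theorem AreConjugate.disjoint_extendScalarsToClosure {W W' : Submodule Ω (ι → Ω)}
    (h : AreConjugate W W') {Λ : Submodule k (ι → k)} (hΛ : Disjoint (extendScalarsToClosure Λ) W) :
    Disjoint (extendScalarsToClosure Λ) W' := by
  obtain ⟨σ, rfl⟩ := h.exists_galoisImage_eq
  rw [Submodule.disjoint_def] at hΛ ⊢
  intro v hv hv'
  rw [← galoisImage_extendScalarsToClosure σ] at hv
  have h0 := hΛ _ hv hv'
  ext i
  have := congrFun h0 i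
  simpa using this

theorem AreConjugate.extendScalarsToClosure_inf {W W' : Submodule Ω (ι → Ω)}
    (h : AreConjugate W W') (H : Submodule k (ι → k)) :
    AreConjugate (extendScalarsToClosure H ⊓ W) (extendScalarsToClosure H ⊓ W') := by
  have himage : ∀ σ : Ω ≃ₐ[k] Ω, galoisImage σ (extendScalarsToClosure H ⊓ W) =
      extendScalarsToClosure H ⊓ galoisImage σ W := fun σ => by
    rw [galoisImage_inf, galoisImage_extendScalarsToClosure]
  have hrange : Set.range (fun σ : Ω ≃ₐ[k] Ω => galoisImage σ (extendScalarsToClosure H ⊓ W)) =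
      (fun U => extendScalarsToClosure H ⊓ U) ''
        Set.range (fun σ : Ω ≃ₐ[k] Ω => galoisImage σ W) := by
    rw [← Set.range_comp]
    exact congrArg Set.range (_root_.funext himage)
  unfold AreConjugate
  rw [hrange, show Set.range _ = _ from h, Set.image_pair]

theorem galoisImage_sup_le {W W' U : Submodule Ω (ι → Ω)} (σ : Ω ≃ₐ[k] Ω)
    (hW : galoisImage σ W ≤ U) (hW' : galoisImage σ W' ≤ U) : galoisImage σ (W ⊔ W') ≤ U := by
  intro v hv
  obtain ⟨x, hx, y, hy, hxy⟩ := Submodule.mem_sup.1 (mem_galoisImage.1 hv)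
  have : v = (fun i => σ (x i)) + fun i => σ (y i) := by
    ext i
    have := congrArg σ (congrFun hxy i)
    simpa using this.symm
  rw [this]
  exact U.add_mem (hW (map_mem_galoisImage.2 hx)) (hW' (map_mem_galoisImage.2 hy))

theorem aeval_galois (σ : Ω ≃ₐ[k] Ω) (v : ι → Ω) (F : MvPolynomial ι k) :
    aeval (fun i => σ (v i)) F = σ (aeval v F) :=
  (comp_aeval_apply v (σ : Ω →ₐ[k] Ω) F).symm

/-- A point fixed by the absolute Galois group is rational. -/
theorem isRationalPoint_of_galois_fixed [CharZero k] {x : PPoint k ι}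
    (h : ∀ σ : Ω ≃ₐ[k] Ω, (fun i => σ (x.rep i)) ∈ x.submodule) : IsRationalPoint x := by
  obtain ⟨i₀, hi₀⟩ := Function.ne_iff.1 x.rep_nonzero
  have hi₀' : x.rep i₀ ≠ 0 := hi₀
  -- Each automorphism multiplies all coordinates by one common scalar, which cancels in their
  -- ratios.
  have hfix : ∀ i, ∃ y : k, algebraMap k Ω y = x.rep i / x.rep i₀ := fun i => by
    refine exists_algebraMap_eq_of_fixed fun σ => ?_
    have hσ := h σ
    rw [Projectivization.submodule_eq, Submodule.mem_span_singleton] at hσ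
    obtain ⟨c, hc⟩ := hσ
    have hci : ∀ i, σ (x.rep i) = c * x.rep i := fun i => (congrFun hc i).symm
    have hc0 : c ≠ 0 := by
      rintro rfl
      have := hci i₀
      rw [zero_mul, map_eq_zero] at this
      exact hi₀' this
    rw [map_div₀, hci, hci, mul_div_mul_left _ _ hc0]
  choose v hv using hfix
  have hvec : (fun i => algebraMap k Ω (v i)) = (x.rep i₀)⁻¹ • x.rep := by
    ext i
    rw [hv, Pi.smul_apply, smul_eq_mul, div_eq_inv_mul]
  have hne : (fun i => algebraMap k Ω (v i)) ≠ 0 := by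
    rw [hvec]
    exact smul_ne_zero (inv_ne_zero hi₀') x.rep_nonzero
  refine ⟨v, hne, ?_⟩
  conv_lhs => rw [← x.mk_rep]
  rw [Projectivization.mk_eq_mk_iff']
  exact ⟨x.rep i₀, by rw [hvec, smul_smul, mul_inv_cancel₀ hi₀', one_smul]⟩

/-- The set whose only element is `x` is stable under Galois, because `F` has coefficients in `k`
and the pair `p`, `q` is preserved. -/
theorem IsThirdPoint.isRationalPoint [CharZero k] {F : MvPolynomial ι k} {m : ℕ}
    (hF : F.IsHomogeneous m) {Wp Wm H : Submodule Ω (ι → Ω)} {p q x : PPoint k ι}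
    (h : IsThirdPoint (hypersurface F) Wp Wm H p q x)
    (hpq : AreConjugate p.submodule q.submodule) : IsRationalPoint x := by
  obtain ⟨-, -, hx⟩ := h
  have hxmem : x ∈ {y | y ∈ hypersurface F ∧ y.submodule ≤ p.submodule ⊔ q.submodule} \ {p, q} := by
    rw [hx]; rfl
  obtain ⟨⟨hxF, hxle⟩, hxne⟩ := hxmem
  simp only [Set.mem_insert_iff, Set.mem_singleton_iff, not_or] at hxne
  have hsym : ∀ σ : Ω ≃ₐ[k] Ω,
      (galoisImage σ p.submodule = p.submodule ∧ galoisImage σ q.submodule = q.submodule) ∨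
      (galoisImage σ p.submodule = q.submodule ∧ galoisImage σ q.submodule = p.submodule) := by
    intro σ
    -- Should the two points coincide, the orbit is a single subspace and nothing is exchanged.
    by_cases heq : p.submodule = q.submodule
    · have : galoisImage σ p.submodule ∈ ({p.submodule, q.submodule} : Set _) := hpq ▸ ⟨σ, rfl⟩
      rw [← heq, Set.pair_eq_singleton, Set.mem_singleton_iff] at this
      exact Or.inl ⟨this, heq ▸ this⟩
    · exact hpq.galoisImage_eq heq σ
  refine isRationalPoint_of_galois_fixed fun σ => ?_
  have hne : (fun i => σ (x.rep i)) ≠ 0 := by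
    intro h0
    refine x.rep_nonzero ?_
    ext i
    have := congrFun h0 i
    simpa using this
  have hsub : (Projectivization.mk Ω _ hne).submodule = galoisImage σ x.submodule := by
    rw [Projectivization.submodule_mk]
    ext v
    rw [mem_galoisImage, Projectivization.submodule_eq, Submodule.mem_span_singleton,
      Submodule.mem_span_singleton]
    constructor
    · rintro ⟨c, rfl⟩
      exact ⟨σ.symm c, by ext i; simp⟩
    · rintro ⟨c, hc⟩
      refine ⟨σ c, ?_⟩
      ext i
      have := congrArg σ (congrFun hc i)
      simpa using this
  have hmem : Projectivization.mk Ω _ hne ∈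
      {y | y ∈ hypersurface F ∧ y.submodule ≤ p.submodule ⊔ q.submodule} \ {p, q} := by
    refine ⟨⟨?_, ?_⟩, ?_⟩
    · rw [mem_hypersurface_mk hF, aeval_galois, show aeval x.rep F = 0 from hxF, map_zero]
    · rw [hsub]
      have hmono : galoisImage σ x.submodule ≤ galoisImage σ (p.submodule ⊔ q.submodule) :=
        fun v hv => hxle hv
      refine hmono.trans ?_
      rcases hsym σ with ⟨h1, h2⟩ | ⟨h1, h2⟩
      · exact galoisImage_sup_le σ (h1.le.trans le_sup_left) (h2.le.trans le_sup_right)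
      · exact galoisImage_sup_le σ (h1.le.trans le_sup_right) (h2.le.trans le_sup_left)
    · simp only [Set.mem_insert_iff, Set.mem_singleton_iff, not_or]
      have hinj := galoisImage_injective (ι := ι) σ
      have hinj' := Projectivization.submodule_injective (K := Ω) (V := ι → Ω)
      rcases hsym σ with ⟨h1, h2⟩ | ⟨h1, h2⟩
      · constructor
        · intro he
          exact hxne.1 (hinj' (hinj (by rw [← hsub, he, h1])))
        · intro he
          exact hxne.2 (hinj' (hinj (by rw [← hsub, he, h2])))
      · constructor
        · intro he
          exact hxne.2 (hinj' (hinj (by rw [← hsub, he, h2])))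
        · intro he
          exact hxne.1 (hinj' (hinj (by rw [← hsub, he, h1])))
  rw [hx, Set.mem_singleton_iff] at hmem
  rw [← hmem, Projectivization.submodule_mk, hmem]
  exact Submodule.mem_span_singleton_self _

end Rational

/-! ### The theorem -/

theorem mainTheorem2 {k : Type*} [Field k] [CharZero k] (n d : ℕ) (hn : 1 ≤ n) (hd : 1 ≤ d)
    (F : MvPolynomial (Fin (2 * n + 2)) k) (hF : F.IsHomogeneous (2 * d + 1))
    (hFirr : Irreducible F)
    (Wp Wm : Submodule (AlgebraicClosure k) (Fin (2 * n + 2) → AlgebraicClosure k))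
    (hdimp : Module.finrank (AlgebraicClosure k) Wp = n + 1)
    (hdimm : Module.finrank (AlgebraicClosure k) Wm = n + 1)
    (hskew : Disjoint Wp Wm)
    (hconj : AreConjugate Wp Wm)
    (hmultp : multiplicityAlong F Wp = d)
    (hmultm : multiplicityAlong F Wm = d) :
    -- the hypersurface is rational over `k`
    IsRationalOver (2 * n) (hypersurface F) ∧
    -- there is an `(n - 1)`-plane over `k` that meets neither of the two `n`-planes
    (∃ Λ : Submodule k (Fin (2 * n + 2) → k), Module.finrank k Λ = n ∧
      Disjoint (extendScalarsToClosure Λ) Wp ∧ Disjoint (extendScalarsToClosure Λ) Wm) ∧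
    -- for each of these, and for each projection `A` from it, which identifies the `(n + 1)`-planes
    -- through it with the lines in `(n + 1)`-space, the third point gives a birational map over `k`
    (∀ Λ : Submodule k (Fin (2 * n + 2) → k), Module.finrank k Λ = n →
      Disjoint (extendScalarsToClosure Λ) Wp → Disjoint (extendScalarsToClosure Λ) Wm →
      ∀ A : Matrix (Fin (n + 2)) (Fin (2 * n + 2)) k, LinearMap.ker A.mulVecLin = Λ →
      ∃ (f : Fin (2 * n + 2) → MvPolynomial (PluckerIndex (n + 2)) k)
        (g : PluckerIndex (n + 2) → MvPolynomial (Fin (2 * n + 2)) k),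
        AreInverseBirational (grassmannianOfLines k (n + 2)) (hypersurface F) f g ∧
        GenericallyOn (grassmannianOfLines k (n + 2)) (fun P =>
          ∃ (H : Submodule (AlgebraicClosure k) (Fin (2 * n + 2) → AlgebraicClosure k))
            (p q x : PPoint k (Fin (2 * n + 2))),
            extendScalarsToClosure Λ ≤ H ∧
            IsPluckerPoint (H.map (A.map (algebraMap k (AlgebraicClosure k))).mulVecLin) P ∧
            IsThirdPoint (hypersurface F) Wp Wm H p q x ∧ SendsTo f P x)) ∧
    -- if the `(n + 1)`-plane is defined over `k`, then the two points are conjugate over `k` and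
    -- the third point is `k`-rational
    (∀ H : Submodule k (Fin (2 * n + 2) → k), Module.finrank k H = n + 2 →
      ∀ p q x : PPoint k (Fin (2 * n + 2)),
        IsThirdPoint (hypersurface F) Wp Wm (extendScalarsToClosure H) p q x →
        AreConjugate p.submodule q.submodule ∧ IsRationalPoint x) := by
  have hWp0 : Wp ≠ ⊥ := by
    rintro rfl
    simp at hdimp
  have hcompl : IsCompl Wp Wm := by
    refine ⟨hskew, codisjoint_iff.2 (Submodule.eq_top_of_finrank_eq ?_)⟩
    have h1 := Submodule.finrank_sup_add_finrank_inf_eq Wp Wm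
    rw [hskew.eq_bot, finrank_bot, hdimp, hdimm] at h1
    rw [Module.finrank_fintype_fun_eq_card, Fintype.card_fin]
    omega
  obtain ⟨J, D, δ, hD, hδ, hJ, hWp, hWm⟩ := hconj.exists_matrix hcompl hWp0
  have hsplit : IsSplitForm J δ d F := fun a b ha hb =>
    exists_aeval_smul_add_smul hd hF
      (fun h => hmultp ▸ iInf_le (fun v : {v // v ∈ Wp ∧ v ≠ 0} => multiplicityAt F v.1)
        ⟨a, (hWp a).2 ha, h⟩)
      (fun h => hmultm ▸ iInf_le (fun v : {v // v ∈ Wm ∧ v ≠ 0} => multiplicityAt F v.1)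
        ⟨b, (hWm b).2 hb, h⟩)
  refine ⟨isRationalOver_hypersurface hD hδ hJ hF hFirr hsplit, ?_, ?_, ?_⟩
  · obtain ⟨Λ, hΛ, -, hdis⟩ := exists_disjoint_extendScalarsToClosure Wp n
      (by rw [hdimp, Fintype.card_fin]; omega)
    exact ⟨Λ, hΛ, hdis, hconj.disjoint_extendScalarsToClosure hdis⟩
  · intro Λ hΛ hΛp hΛm A hA
    have hker : LinearMap.ker (extendMatrix (AlgebraicClosure k) A) = extendScalarsToClosure Λ := by
      rw [← hA]
      exact le_antisymm (fun v hv => mem_extendScalarsToClosure_ker hv)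
        (extendScalarsToClosure_ker_le A)
    have hinj : ∀ W, Disjoint (extendScalarsToClosure Λ) W →
        ∀ v ∈ W, extendMatrix (AlgebraicClosure k) A v = 0 → v = 0 := fun W hW v hv h0 =>
      Submodule.disjoint_def.1 hW v (hker ▸ h0) hv
    have hsurj : Function.Surjective A.mulVecLin := by
      rw [← LinearMap.range_eq_top]
      refine Submodule.eq_top_of_finrank_eq ?_
      have h1 := LinearMap.finrank_range_add_finrank_ker A.mulVecLin
      rw [hA, hΛ, Module.finrank_fintype_fun_eq_card, Fintype.card_fin] at h1
      rw [Module.finrank_fintype_fun_eq_card, Fintype.card_fin]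
      omega
    have hsurj' : Function.Surjective (extendMatrix (AlgebraicClosure k) A) := by
      obtain ⟨B, hB⟩ := Matrix.mulVec_surjective_iff_exists_right_inverse.1 hsurj
      intro u
      refine ⟨extendMatrix _ B u, ?_⟩
      rw [← extendMatrix_mul, hB]
      simp [extendMatrix]
    -- With `v = a + b`, the vanishing of `Av` and `AJv` gives `Aa = Ab = 0`, and `Λ` meets neither
    -- eigenspace.
    have hinjk : ∀ v, A.mulVec v = 0 → (A * J).mulVec v = 0 → v = 0 := by
      intro v h1 h2
      have : CharZero (AlgebraicClosure k) := algebraRat.charZero _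
      obtain ⟨a, b, ha, hb, hab⟩ := exists_eigenvectors (K := AlgebraicClosure k) hD hδ hJ
        (fun i => algebraMap k _ (v i))
      have hδ0 := ne_zero_of_not_isSquare hD hδ
      have hAx : extendMatrix (AlgebraicClosure k) A (a + b) = 0 := by
        rw [← hab, extendMatrix_algebraMap, h1]
        ext i
        simp
      have hAJx : extendMatrix (AlgebraicClosure k) A (extendMatrix _ J (a + b)) = 0 := by
        rw [← extendMatrix_mul, ← hab, extendMatrix_algebraMap, h2]
        ext i
        simp
      rw [map_add, ha, hb, map_add, map_smul, map_smul] at hAJx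
      rw [map_add] at hAx
      have hAa : (2 * δ) • extendMatrix (AlgebraicClosure k) A a = 0 := by
        have key : (2 * δ) • extendMatrix (AlgebraicClosure k) A a =
            (δ • extendMatrix (AlgebraicClosure k) A a +
              (-δ) • extendMatrix (AlgebraicClosure k) A b) +
            δ • (extendMatrix (AlgebraicClosure k) A a +
              extendMatrix (AlgebraicClosure k) A b) := by module
        rw [key, hAJx, hAx, smul_zero, add_zero]
      rw [smul_eq_zero_iff_right (mul_ne_zero two_ne_zero hδ0)] at hAa
      rw [hAa, zero_add] at hAx
      rw [hinj _ hΛp a ((hWp a).2 ha) hAa, hinj _ hΛm b ((hWm b).2 hb) hAx, add_zero] at hab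
      ext i
      simpa using congrFun hab i
    obtain ⟨L⟩ := exists_liftData hsurj hinjk (by rw [Fintype.card_fin]; omega)
    refine ⟨L.lineMap F D d, projectedLine A J,
      L.areInverseBirational rfl hD hδ hJ hF hFirr hsplit Wp Wm hWp hWm hdimp hdimm (hinj _ hΛp)
        (hinj _ hΛm), ?_⟩
    have := L.genericallyOn_isThirdPoint rfl hD hδ hJ hd hF hFirr hsplit Wp Wm hWp hWm hdimp hdimm
      (hinj _ hΛp) (hinj _ hΛm) hsurj'
    rwa [hker] at this
  · intro H _ p q x hx
    have hpq : AreConjugate p.submodule q.submodule := by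
      rw [← hx.1, ← hx.2.1]
      exact hconj.extendScalarsToClosure_inf H
    exact ⟨hpq, hx.isRationalPoint hF hpq⟩
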